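/- Smoothness, manifolds and Lie groups are understood in the sense of the Michal--Bastiani calculus on real Hausdorff locally convex spaces: for $U \subseteq X$ open, a map $f : U \to Y$ is $C^1$ if it is continuous, all directional derivatives $df(x)(h)=\lim_{t\to 0}\frac1t(f(x+th)-f(x))$ exist and $df : U\times X \to Y$ is continuous; it is $C^n$ if it is $C^1$ and $df$ is $C^{n-1}$, and smooth if it is $C^n$ for all $n$. A Lie group $G$ is a group with a smooth manifold structure modelled on a locally convex space for which multiplication and inversion are smooth; its Lie algebra is $\mathbf{L}(G)=T_{\mathbf 1}(G)$ with the bracket of left invariant vector fields. A Lie group $G$ with Lie algebra $\mathfrak g$ is called regular if for each $\xi \in C^\infty([0,1],\mathfrak g)$ the initial value problem $\gamma(0)=\mathbf 1$, $\gamma'(t)=T(\lambda_{\gamma(t)})\xi(t)$ (where $\lambda_g(x)=gx$) has a solution $\gamma_\xi \in C^\infty([0,1],G)$, and the map $C^\infty([0,1],\mathfrak g)\to G$, $\xi\mapsto\gamma_\xi(1)$, is smooth. For a locally convex space $E$ and a finite-dimensional manifold $M$, or $M=[0,1]$, the space $C^\infty(M,E)$ carries the smooth compact open topology, i.e. the topology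 induced by $f \mapsto (T^k f)_{k \ge 0}$ from the compact open topologies on the spaces $C(T^kM,T^kE)$. Let $M$ be a connected (Hausdorff) finite-dimensional smooth manifold without boundary and $K$ a regular Lie group with Lie algebra $\mathfrak k$. A Lie group structure on the group $C^\infty(M,K)$ of smooth maps, with pointwise multiplication, is called compatible with evaluations if its Lie algebra is the topological Lie algebra $C^\infty(M,\mathfrak k)$ (with the pointwise bracket) and every evaluation map $\mathrm{ev}_m : C^\infty(M,K)\to K$, $f\mapsto f(m)$, $m \in M$, is smooth with $\mathbf L(\mathrm{ev}_m)=\mathrm{ev}_m : C^\infty(M,\mathfrak k)\to\mathfrak k$. (The topology of the Lie group structure is not assumed to be related to the smooth compact open topology on $C^\infty(M,K)$.) Then there is at most one regular Lie group structure on $C^\infty(M,K)$ which is compatible with evaluations: if $G_1$ and $G_2$ are the Lie groups obtained from two such structures, then the identity map $G_1\to G_2$ is a diffeomorphism. -/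

import Mathlib

namespace LCCalculus

open Set Filter Topology

universe u v w u₁ u₂ u₃


section Calculus

variable {X : Type u} [AddCommGroup X] [Module ℝ X] [TopologicalSpace X]
variable {X' : Type u₁} [AddCommGroup X'] [Module ℝ X'] [TopologicalSpace X']
variable {Y : Type v} [AddCommGroup Y] [Module ℝ Y] [TopologicalSpace Y]
variable {Y' : Type u₂} [AddCommGroup Y'] [Module ℝ Y'] [TopologicalSpace Y']
variable {Z : Type w} [AddCommGroup Z] [Module ℝ Z] [TopologicalSpace Z]

/-- `y` is the derivative of `f : U → Y` at `x ∈ U` in the direction `h`, i.e. the limit of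
`t⁻¹ • (f (x + t • h) - f x)` as `t → 0`, `t ≠ 0`. If `U` is open, the requirement
`x + t • h ∈ U` is void for small `t`; for `U = [0,1] ⊆ ℝ` it gives the one-sided derivatives at
the end points. -/
def HasDirDeriv (f : X → Y) (U : Set X) (x h : X) (y : Y) : Prop :=
  Tendsto (fun t : ℝ => t⁻¹ • (f (x + t • h) - f x)) (𝓝[{t : ℝ | t ≠ 0 ∧ x + t • h ∈ U}] 0) (𝓝 y)

/-- The derivative `df(x)(h)` of `f : U → Y`, as a function (meaningful where the limit exists). -/
noncomputable def dirDeriv (f : X → Y) (U : Set X) (x h : X) : Y :=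
  limUnder (𝓝[{t : ℝ | t ≠ 0 ∧ x + t • h ∈ U}] 0) (fun t : ℝ => t⁻¹ • (f (x + t • h) - f x))

/-- `f : U → Y` is a `C^n`-map: it is continuous and, if `n ≥ 1`, all directional derivatives exist
and `df : U × X → Y` is a `C^(n-1)`-map. Used for open `U`, for `U` open in `[0,1]`, and for products
of such sets with vector spaces. -/
def CnOn {Y : Type v} [AddCommGroup Y] [Module ℝ Y] [TopologicalSpace Y] :
    ℕ → ∀ {X : Type u} [AddCommGroup X] [Module ℝ X] [TopologicalSpace X], (X → Y) → Set X → Prop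
  | 0, _, _, _, _, f, U => ContinuousOn f U
  | n + 1, X, _, _, _, f, U => ContinuousOn f U ∧ ∃ df : X × X → Y,
      (∀ x ∈ U, ∀ h, HasDirDeriv f U x h (df (x, h))) ∧ CnOn n df (U ×ˢ univ)

/-- `f : U → Y` is smooth. -/
def SmoothOn (f : X → Y) (U : Set X) : Prop := ∀ n, CnOn n f U

theorem CnOn.continuousOn {n : ℕ} {f : X → Y} {U : Set X} (hf : CnOn n f U) : ContinuousOn f U := by
  cases n with
  | zero => exact hf
  | succ n => exact hf.1

theorem CnOn.of_succ {n : ℕ} : ∀ {X : Type u} [AddCommGroup X] [Module ℝ X] [TopologicalSpace X]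
    {f : X → Y} {U : Set X}, CnOn (n + 1) f U → CnOn n f U := by
  induction n with
  | zero => intro X _ _ _ f U h; exact h.1
  | succ n ih =>
    rintro X _ _ _ f U ⟨h, df, h1, h2⟩
    exact ⟨h, df, h1, ih h2⟩

theorem HasDirDeriv.mono {f : X → Y} {U W : Set X} {x h : X} {y : Y}
    (hf : HasDirDeriv f U x h y) (hW : W ⊆ U) : HasDirDeriv f W x h y :=
  hf.mono_left (nhdsWithin_mono _ fun _ ht => ⟨ht.1, hW ht.2⟩)

theorem HasDirDeriv.congr {f g : X → Y} {U : Set X} {x h : X} {y : Y}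
    (hf : HasDirDeriv f U x h y) (hx : x ∈ U) (hfg : EqOn f g U) : HasDirDeriv g U x h y := by
  refine Tendsto.congr' ?_ hf
  filter_upwards [self_mem_nhdsWithin] with t ht
  rw [hfg ht.2, hfg hx]

theorem CnOn.mono {n : ℕ} : ∀ {X : Type u} [AddCommGroup X] [Module ℝ X] [TopologicalSpace X]
    {f : X → Y} {U W : Set X}, CnOn n f U → W ⊆ U → CnOn n f W := by
  induction n with
  | zero => intro X _ _ _ f U W h hW; exact ContinuousOn.mono h hW
  | succ n ih =>
    rintro X _ _ _ f U W ⟨h, df, h1, h2⟩ hW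
    exact ⟨h.mono hW, df, fun x hx k => (h1 x (hW hx) k).mono hW,
      ih h2 (prod_mono hW Subset.rfl)⟩

theorem CnOn.congr {n : ℕ} {f g : X → Y} {U : Set X} (hf : CnOn n f U) (hfg : EqOn f g U) :
    CnOn n g U := by
  cases n with
  | zero => exact ContinuousOn.congr hf hfg.symm
  | succ n =>
    obtain ⟨h, df, h1, h2⟩ := hf
    exact ⟨h.congr hfg.symm, df, fun x hx k => (h1 x hx k).congr hx hfg, h2⟩

theorem CnOn.const {n : ℕ} (c : Y) :
    ∀ {X : Type u} [AddCommGroup X] [Module ℝ X] [TopologicalSpace X] (U : Set X),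
    CnOn n (fun _ : X => c) U := by
  induction n generalizing c with
  | zero => intro X _ _ _ U; exact continuousOn_const
  | succ n ih =>
    intro X _ _ _ U
    refine ⟨continuousOn_const, fun _ => 0, fun x _ k => ?_, ih 0 _⟩
    simp only [HasDirDeriv, sub_self, smul_zero]
    exact tendsto_const_nhds

theorem CnOn.prodMk {n : ℕ} : ∀ {X : Type u} [AddCommGroup X] [Module ℝ X] [TopologicalSpace X]
    {f : X → Y} {g : X → Y'} {U : Set X}, CnOn n f U → CnOn n g U →
    CnOn n (fun x => (f x, g x)) U := by
  induction n with
  | zero => intro X _ _ _ f g U hf hg; exact ContinuousOn.prodMk hf hg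
  | succ n ih =>
    rintro X _ _ _ f g U ⟨hf, df, hf1, hf2⟩ ⟨hg, dg, hg1, hg2⟩
    exact ⟨hf.prodMk hg, fun p => (df p, dg p),
      fun x hx k => (hf1 x hx k).prodMk_nhds (hg1 x hx k), ih hf2 hg2⟩

/-- Composition with a continuous linear map on the right. -/
theorem CnOn.comp_linear {n : ℕ} : ∀ {X : Type u} [AddCommGroup X] [Module ℝ X] [TopologicalSpace X]
    {X' : Type u₁} [AddCommGroup X'] [Module ℝ X'] [TopologicalSpace X']
    {f : X → Y} {U : Set X}, CnOn n f U → ∀ L : X' →L[ℝ] X, CnOn n (fun x => f (L x)) (L ⁻¹' U) := by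
  induction n with
  | zero =>
    intro X _ _ _ X' _ _ _ f U hf L
    exact ContinuousOn.comp hf L.continuous.continuousOn fun x hx => hx
  | succ n ih =>
    rintro X _ _ _ X' _ _ _ f U ⟨hf, df, hf1, hf2⟩ L
    refine ⟨hf.comp L.continuous.continuousOn fun x hx => hx,
      fun p => df (L p.1, L p.2), fun x hx k => ?_, ?_⟩
    · have := hf1 (L x) hx (L k)
      simpa [HasDirDeriv, map_add, map_smul] using this
    · have := ih hf2 (L.prodMap L)
      refine this.mono ?_
      rintro ⟨a, b⟩ hab
      simpa using hab

/-- Composition with a continuous linear map on the left. -/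
theorem CnOn.linear_comp {n : ℕ} (L : Y →L[ℝ] Y') :
    ∀ {X : Type u} [AddCommGroup X] [Module ℝ X] [TopologicalSpace X]
    {f : X → Y} {U : Set X}, CnOn n f U → CnOn n (fun x => L (f x)) U := by
  induction n with
  | zero => intro X _ _ _ f U hf; exact L.continuous.comp_continuousOn hf
  | succ n ih =>
    rintro X _ _ _ f U ⟨hf, df, hf1, hf2⟩
    refine ⟨L.continuous.comp_continuousOn hf, fun p => L (df p), fun x hx k => ?_, ih hf2⟩
    have := (L.continuous.tendsto _).comp (hf1 x hx k)
    simpa [HasDirDeriv, Function.comp_def, map_sub, map_smul] using this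

section Chain

variable [IsTopologicalAddGroup Y] [ContinuousSMul ℝ Y]
variable [IsTopologicalAddGroup Z] [ContinuousSMul ℝ Z] [LocallyConvexSpace ℝ Z]

/-- Mean value estimate along a segment. -/
theorem segment_mem {g : Y → Z} {V : Set Y} {dg : Y × Y → Z} (hV : IsOpen V)
    (hg : ∀ y ∈ V, ∀ k, HasDirDeriv g V y k (dg (y, k)))
    {W : Set Z} (hW : Convex ℝ W) (hWc : IsClosed W) {y k : Y} {t : ℝ} (ht : t ≠ 0)
    (hseg : ∀ s ∈ Icc (0 : ℝ) 1, y + (s * t) • k ∈ V ∧ dg (y + (s * t) • k, k) ∈ W) :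
    t⁻¹ • (g (y + t • k) - g y) ∈ W := by
  by_contra hn
  obtain ⟨l, c, hl, hc⟩ := geometric_hahn_banach_closed_point hW hWc hn
  let φ : ℝ → ℝ := fun s => t⁻¹ * l (g (y + (s * t) • k))
  have hφ : ∀ s ∈ Icc (0 : ℝ) 1, HasDerivAt φ (l (dg (y + (s * t) • k, k))) s := by
    intro s hs
    obtain ⟨hy, -⟩ := hseg s hs
    have h1 := (l.continuous.tendsto _).comp (hg _ hy k)
    rw [hasDerivAt_iff_tendsto_slope_zero]
    have h2 : Tendsto (fun r : ℝ => r * t) (𝓝[≠] 0)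
        (𝓝[{r : ℝ | r ≠ 0 ∧ y + (s * t) • k + r • k ∈ V}] 0) := by
      have h3 : Tendsto (fun r : ℝ => r * t) (𝓝 0) (𝓝 0) := by
        simpa using (continuous_mul_const t).tendsto (0 : ℝ)
      refine tendsto_nhdsWithin_iff.2 ⟨h3.mono_left nhdsWithin_le_nhds, ?_⟩
      have h4 : Tendsto (fun r : ℝ => y + (s * t) • k + (r * t) • k) (𝓝 0)
          (𝓝 (y + (s * t) • k)) := by
        have h5 : Continuous fun r : ℝ => y + (s * t) • k + (r * t) • k := by fun_prop
        simpa using h5.tendsto 0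
      filter_upwards [self_mem_nhdsWithin,
        (h4.eventually (hV.mem_nhds hy)).filter_mono nhdsWithin_le_nhds] with r hr hr'
      exact ⟨mul_ne_zero hr ht, hr'⟩
    refine (h1.comp h2).congr' ?_
    filter_upwards [self_mem_nhdsWithin] with r hr
    have h6 : y + (s * t) • k + (r * t) • k = y + ((s + r) * t) • k := by
      rw [add_assoc, ← add_smul, ← add_mul]
    simp only [Function.comp_apply, h6, map_smul, map_sub, smul_eq_mul, φ, mul_inv]
    ring
  obtain ⟨s, hs, hs'⟩ := exists_hasDerivAt_eq_slope φ
    (fun s => l (dg (y + (s * t) • k, k))) zero_lt_one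
    (fun s hs => (hφ s hs).continuousAt.continuousWithinAt)
    (fun s hs => hφ s ⟨hs.1.le, hs.2.le⟩)
  have h7 := hl _ (hseg s ⟨hs.1.le, hs.2.le⟩).2
  have h8 : l (t⁻¹ • (g (y + t • k) - g y)) = φ 1 - φ 0 := by
    simp [φ, mul_sub]
  simp only [sub_zero, div_one] at hs'
  rw [hs', ← h8] at h7
  exact absurd (h7.trans hc) (lt_irrefl _)

/-- The chain rule for directional derivatives. -/
theorem HasDirDeriv.comp {f : X → Y} {g : Y → Z} {U : Set X} {V : Set Y} (hV : IsOpen V)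
    (hUV : MapsTo f U V) {dg : Y × Y → Z} (hg : ∀ y ∈ V, ∀ k, HasDirDeriv g V y k (dg (y, k)))
    (hdg : ContinuousOn dg (V ×ˢ univ)) {x h : X} (hx : x ∈ U) {k : Y}
    (hf : HasDirDeriv f U x h k) : HasDirDeriv (fun x => g (f x)) U x h (dg (f x, k)) := by
  rw [HasDirDeriv, ((closed_nhds_basis (dg (f x, k)))).tendsto_right_iff]
  rintro W₀ ⟨hW₀, hW₀c⟩
  obtain ⟨W, ⟨hW, hWconv⟩, hWW₀⟩ :=
    (LocallyConvexSpace.convex_basis (𝕜 := ℝ) (dg (f x, k))).mem_iff.1 hW₀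
  have hcl : closure W ⊆ W₀ := closure_minimal hWW₀ hW₀c
  have hWcl : closure W ∈ 𝓝 (dg (f x, k)) := mem_of_superset hW subset_closure
  have hopen : IsOpen (V ×ˢ (univ : Set Y)) := hV.prod isOpen_univ
  have hmem : (f x, k) ∈ V ×ˢ (univ : Set Y) := ⟨hUV hx, trivial⟩
  have hA : {p : Y × Y | p ∈ V ×ˢ (univ : Set Y) ∧ dg p ∈ closure W} ∈ 𝓝 (f x, k) := by
    filter_upwards [hopen.mem_nhds hmem, (hdg.continuousAt (hopen.mem_nhds hmem)) hWcl]
      with p hp hp' using ⟨hp, hp'⟩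
  have hcont : Continuous fun q : ℝ × Y => (f x + q.1 • q.2, q.2) := by fun_prop
  have hB : {q : ℝ × Y | (f x + q.1 • q.2, q.2) ∈
      {p : Y × Y | p ∈ V ×ˢ (univ : Set Y) ∧ dg p ∈ closure W}} ∈ 𝓝 ((0 : ℝ), k) := by
    refine hcont.continuousAt ?_
    simpa using hA
  rw [nhds_prod_eq, mem_prod_iff] at hB
  obtain ⟨R, hR, B, hB, hRB⟩ := hB
  obtain ⟨ε, hε, hεR⟩ := Metric.mem_nhds_iff.1 hR
  have ht0 : ∀ᶠ t : ℝ in 𝓝[{t : ℝ | t ≠ 0 ∧ x + t • h ∈ U}] 0, t ∈ Metric.ball (0 : ℝ) ε :=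
    nhdsWithin_le_nhds (Metric.ball_mem_nhds _ hε)
  filter_upwards [self_mem_nhdsWithin, hf hB, ht0] with t ht hk hε'
  refine hcl ?_
  have hfx : f (x + t • h) = f x + t • (t⁻¹ • (f (x + t • h) - f x)) := by
    rw [smul_inv_smul₀ ht.1]; abel
  rw [hfx]
  refine segment_mem hV hg hWconv.closure isClosed_closure ht.1 fun s hs => ?_
  have hst : s * t ∈ R := by
    apply hεR
    rw [mem_ball_zero_iff, Real.norm_eq_abs] at hε' ⊢
    rw [abs_mul]
    calc |s| * |t| ≤ 1 * |t| := by
          gcongr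
          rw [abs_of_nonneg hs.1]; exact hs.2
      _ < ε := by simpa using hε'
  have := hRB (mk_mem_prod hst hk)
  exact ⟨this.1.1, this.2⟩

end Chain

/-- Composition of `C^n`-maps. -/
theorem CnOn.comp [IsTopologicalAddGroup Z] [ContinuousSMul ℝ Z] [LocallyConvexSpace ℝ Z] {n : ℕ} :
    ∀ {X : Type u} [AddCommGroup X] [Module ℝ X] [TopologicalSpace X]
    {Y : Type v} [AddCommGroup Y] [Module ℝ Y] [TopologicalSpace Y] [IsTopologicalAddGroup Y]
    [ContinuousSMul ℝ Y] {g : Y → Z} {f : X → Y} {U : Set X} {V : Set Y}, IsOpen V →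
    CnOn n g V → CnOn n f U → MapsTo f U V → CnOn n (fun x => g (f x)) U := by
  induction n with
  | zero =>
    intro X _ _ _ Y _ _ _ _ _ g f U V _ hg hf hUV
    exact ContinuousOn.comp hg hf hUV
  | succ n ih =>
    intro X _ _ _ Y _ _ _ _ _ g f U V hV hg hf hUV
    have hf' := hf.of_succ
    obtain ⟨hgc, dg, hg1, hg2⟩ := hg
    obtain ⟨hfc, df, hf1, hf2⟩ := hf
    refine ⟨hgc.comp hfc hUV, fun p => dg (f p.1, df p),
      fun x hx h => (hf1 x hx h).comp hV hUV hg1 hg2.continuousOn hx, ?_⟩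
    have h1 : CnOn n (fun p : X × X => f p.1) (U ×ˢ univ) := by
      refine (hf'.comp_linear (ContinuousLinearMap.fst ℝ X X)).mono ?_
      rintro ⟨a, b⟩ hab
      exact hab.1
    exact ih (hV.prod isOpen_univ) hg2 (h1.prodMk hf2) fun p hp => ⟨hUV hp.1, trivial⟩

theorem dir_neBot [IsTopologicalAddGroup X] [ContinuousSMul ℝ X] {U : Set X} (hU : IsOpen U)
    {x : X} (hx : x ∈ U) (h : X) : (𝓝[{t : ℝ | t ≠ 0 ∧ x + t • h ∈ U}] (0 : ℝ)).NeBot := by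
  have hc : Tendsto (fun t : ℝ => x + t • h) (𝓝 0) (𝓝 x) := by
    have : Continuous fun t : ℝ => x + t • h := by fun_prop
    simpa using this.tendsto 0
  have hmem : (fun t : ℝ => x + t • h) ⁻¹' U ∈ 𝓝 (0 : ℝ) := hc (hU.mem_nhds hx)
  have : 𝓝[{t : ℝ | t ≠ 0 ∧ x + t • h ∈ U}] (0 : ℝ) = 𝓝[≠] 0 := by
    have h2 : {t : ℝ | t ≠ 0 ∧ x + t • h ∈ U} = {0}ᶜ ∩ (fun t : ℝ => x + t • h) ⁻¹' U := rfl
    rw [h2, nhdsWithin_inter_of_mem' (nhdsWithin_le_nhds hmem)]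
  rw [this]
  infer_instance

theorem HasDirDeriv.of_inter [IsTopologicalAddGroup X] [ContinuousSMul ℝ X] {f : X → Y}
    {U V : Set X} (hV : IsOpen V) {x h : X} {y : Y} (hx : x ∈ V)
    (hf : HasDirDeriv f (U ∩ V) x h y) : HasDirDeriv f U x h y := by
  have hc : Tendsto (fun t : ℝ => x + t • h) (𝓝 0) (𝓝 x) := by
    have : Continuous fun t : ℝ => x + t • h := by fun_prop
    simpa using this.tendsto 0
  have hmem : (fun t : ℝ => x + t • h) ⁻¹' V ∈ 𝓝 (0 : ℝ) := hc (hV.mem_nhds hx)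
  have h2 : {t : ℝ | t ≠ 0 ∧ x + t • h ∈ U ∩ V} =
      {t : ℝ | t ≠ 0 ∧ x + t • h ∈ U} ∩ (fun t : ℝ => x + t • h) ⁻¹' V := by
    ext t; simp [and_assoc]
  rw [HasDirDeriv, h2, nhdsWithin_inter_of_mem' (nhdsWithin_le_nhds hmem)] at hf
  exact hf

/-- Being `C^n` is a local property. -/
theorem CnOn.of_local [T2Space Y] {n : ℕ} :
    ∀ {X : Type u} [AddCommGroup X] [Module ℝ X] [TopologicalSpace X]
    [IsTopologicalAddGroup X] [ContinuousSMul ℝ X] {f : X → Y} {U : Set X}, IsOpen U →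
    (∀ x ∈ U, ∃ V, IsOpen V ∧ x ∈ V ∧ CnOn n f (U ∩ V)) → CnOn n f U := by
  induction n with
  | zero =>
    intro X _ _ _ _ _ f U hU hf
    exact continuousOn_of_locally_continuousOn fun x hx => hf x hx
  | succ n ih =>
    intro X _ _ _ _ _ f U hU hf
    have hcont : ContinuousOn f U := continuousOn_of_locally_continuousOn fun x hx =>
      let ⟨V, hV, hxV, h⟩ := hf x hx
      ⟨V, hV, hxV, h.continuousOn⟩
    have hf' : ∀ x : U, ∃ V, IsOpen V ∧ x.1 ∈ V ∧ ∃ df : X × X → Y,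
        (∀ z ∈ U ∩ V, ∀ h, HasDirDeriv f (U ∩ V) z h (df (z, h))) ∧
          CnOn n df ((U ∩ V) ×ˢ univ) := fun x =>
      let ⟨V, hV, hxV, h⟩ := hf x.1 x.2
      ⟨V, hV, hxV, h.2⟩
    choose V hV hxV D hD1 hD2 using hf'
    classical
    let df : X × X → Y := fun p => if hp : p.1 ∈ U then D ⟨p.1, hp⟩ p else 0
    have hdf : ∀ x ∈ U, ∀ h, HasDirDeriv f U x h (df (x, h)) := by
      intro x hx h
      simp only [df, hx, dif_pos]
      exact (hD1 ⟨x, hx⟩ x ⟨hx, hxV _⟩ h).of_inter (hV _) (hxV ⟨x, hx⟩)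
    refine ⟨hcont, df, hdf, ih (hU.prod isOpen_univ) ?_⟩
    rintro ⟨x, h⟩ ⟨hx, -⟩
    refine ⟨V ⟨x, hx⟩ ×ˢ univ, (hV _).prod isOpen_univ, ⟨hxV ⟨x, hx⟩, trivial⟩, ?_⟩
    have hsub : U ×ˢ (univ : Set X) ∩ V ⟨x, hx⟩ ×ˢ univ = (U ∩ V ⟨x, hx⟩) ×ˢ univ := by
      rw [prod_inter_prod, univ_inter]
    rw [hsub]
    refine (hD2 ⟨x, hx⟩).congr ?_
    rintro ⟨z, k⟩ ⟨⟨hzU, hzV⟩, -⟩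
    have := dir_neBot hU hzU k
    exact tendsto_nhds_unique ((hD1 ⟨x, hx⟩ z ⟨hzU, hzV⟩ k).of_inter (hV _) hzV) (hdf z hzU k)

end Calculus

section SmoothCompactOpen

/-- The tangent map `Tf : U × X → Y × Y`, `(x, h) ↦ (f x, df(x)(h))`. -/
noncomputable def tangentMap {X : Type u} [AddCommGroup X] [Module ℝ X] [TopologicalSpace X]
    {Y : Type v} [AddCommGroup Y] [Module ℝ Y] [TopologicalSpace Y] (U : Set X) (f : X → Y) :
    X × X → Y × Y :=
  fun p => (f p.1, dirDeriv f U p.1 p.2)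

/-- The topology on maps `f : U → Y` induced by `f ↦ T^k f : T^k U → T^k Y` from the compact open
topology, where `T^0 U = U` and `T^(k+1) U = T^k (U × X)`. -/
@[reducible] noncomputable def tangentCompactOpen : ℕ → ∀ {X : Type u} [AddCommGroup X] [Module ℝ X] [TopologicalSpace X]
    {Y : Type v} [AddCommGroup Y] [Module ℝ Y] [TopologicalSpace Y],
    Set X → TopologicalSpace (X → Y)
  | 0, _, _, _, _, _, _, _, _, U => TopologicalSpace.generateFrom
      {s | ∃ C V, IsCompact C ∧ C ⊆ U ∧ IsOpen V ∧ s = {f | MapsTo f C V}}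
  | k + 1, _, _, _, _, _, _, _, _, U =>
      (tangentCompactOpen k (U ×ˢ univ)).induced (tangentMap U)

end SmoothCompactOpen

/-! ### Manifolds modelled on locally convex spaces -/

section Manifold

variable {E : Type u} [AddCommGroup E] [Module ℝ E] [TopologicalSpace E]
variable {F : Type v} [AddCommGroup F] [Module ℝ F] [TopologicalSpace F]
variable {H : Type w} [AddCommGroup H] [Module ℝ H] [TopologicalSpace H]
variable {M : Type u₁} [TopologicalSpace M]
variable {N : Type u₂} [TopologicalSpace N]
variable {P : Type u₃} [TopologicalSpace P]

instance : AddCommGroup (ModelProd E F) := inferInstanceAs (AddCommGroup (E × F))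

instance : Module ℝ (ModelProd E F) := inferInstanceAs (Module ℝ (E × F))

/-- The map `f : M → N` in the charts `e` of `M` and `e'` of `N`. -/
def localRep (e : OpenPartialHomeomorph M E) (e' : OpenPartialHomeomorph N F) (f : M → N) : E → F :=
  fun x => e' (f (e.symm x))

/-- The domain of definition of `localRep e e' f`. -/
def localDom (e : OpenPartialHomeomorph M E) (e' : OpenPartialHomeomorph N F) (f : M → N) : Set E :=
  e.target ∩ e.symm ⁻¹' (f ⁻¹' e'.source)

variable (E F)

/-- `M` is a smooth manifold modelled on `E`: all changes of charts are smooth. -/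
class IsLCManifold (M : Type u₁) [TopologicalSpace M] [ChartedSpace E M] : Prop where
  smooth_chart_change : ∀ e ∈ atlas E M, ∀ e' ∈ atlas E M,
    SmoothOn (localRep e e' id) (localDom e e' id)

/-- Smooth maps between manifolds modelled on `E` and `F`. -/
def Smooth [ChartedSpace E M] [ChartedSpace F N] (f : M → N) : Prop :=
  Continuous f ∧ ∀ e ∈ atlas E M, ∀ e' ∈ atlas F N, SmoothOn (localRep e e' f) (localDom e e' f)

/-- The tangent map `T_p f : T_p M → T_(f p) N`. As usual for charted spaces, `T_p M` is identified
with the model space by means of the preferred chart `chartAt E p` at `p`. -/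
noncomputable def tangentMapAt [ChartedSpace E M] [ChartedSpace F N] (f : M → N) (p : M) (v : E) :
    F :=
  dirDeriv (localRep (chartAt E p) (chartAt F (f p)) f)
    (localDom (chartAt E p) (chartAt F (f p)) f) (chartAt E p p) v

variable {E F}

theorem isOpen_localDom (e : OpenPartialHomeomorph M E) (e' : OpenPartialHomeomorph N F) {f : M → N}
    (hf : Continuous f) : IsOpen (localDom e e' f) :=
  e.isOpen_inter_preimage_symm (e'.open_source.preimage hf)

theorem Smooth.const [ChartedSpace E M] [ChartedSpace F N] (c : N) :
    Smooth E F (fun _ : M => c) :=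
  ⟨continuous_const, fun _ _ _ _ _ => CnOn.const _ _⟩

theorem Smooth.comp [IsTopologicalAddGroup E] [ContinuousSMul ℝ E]
    [IsTopologicalAddGroup F] [ContinuousSMul ℝ F]
    [IsTopologicalAddGroup H] [ContinuousSMul ℝ H] [LocallyConvexSpace ℝ H] [T2Space H]
    [ChartedSpace E M] [ChartedSpace F N] [ChartedSpace H P] {g : N → P} {f : M → N}
    (hg : Smooth F H g) (hf : Smooth E F f) : Smooth E H (fun x => g (f x)) := by
  have hc : Continuous fun x => g (f x) := hg.1.comp hf.1
  refine ⟨hc, fun e he e'' he'' n => ?_⟩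
  refine CnOn.of_local (isOpen_localDom e e'' hc) fun x hx => ?_
  let e' := chartAt F (f (e.symm x))
  have he' : e' ∈ atlas F N := chart_mem_atlas F _
  refine ⟨localDom e e' f, isOpen_localDom e e' hf.1, ⟨hx.1, mem_chart_source F _⟩, ?_⟩
  have h1 : CnOn n (localRep e e' f) (localDom e e'' (fun x => g (f x)) ∩ localDom e e' f) :=
    (hf.2 e he e' he' n).mono inter_subset_right
  have h2 := hg.2 e' he' e'' he'' n
  have hmaps : MapsTo (localRep e e' f) (localDom e e'' (fun x => g (f x)) ∩ localDom e e' f)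
      (localDom e' e'' g) := by
    rintro y ⟨hy1, hy2⟩
    refine ⟨e'.map_source hy2.2, ?_⟩
    have h3 : e'.symm (e' (f (e.symm y))) = f (e.symm y) := e'.left_inv hy2.2
    simp only [localRep, mem_preimage, h3]
    exact hy1.2
  refine (CnOn.comp (isOpen_localDom e' e'' hg.1) h2 h1 hmaps).congr ?_
  rintro y ⟨hy1, hy2⟩
  have h3 : e'.symm (e' (f (e.symm y))) = f (e.symm y) := e'.left_inv hy2.2
  simp only [localRep, h3]

theorem Smooth.prodMk [ChartedSpace E M] [ChartedSpace F N] [ChartedSpace H P]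
    {f : M → N} {g : M → P} (hf : Smooth E F f) (hg : Smooth E H g) :
    Smooth E (ModelProd F H) (fun x => (f x, g x)) := by
  refine ⟨hf.1.prodMk hg.1, ?_⟩
  rintro e he e' ⟨e₁, he₁, e₂, he₂, rfl⟩ n
  have h1 := (hf.2 e he e₁ he₁ n).mono (W := localDom e e₁ f ∩ localDom e e₂ g) inter_subset_left
  have h2 := (hg.2 e he e₂ he₂ n).mono (W := localDom e e₁ f ∩ localDom e e₂ g) inter_subset_right
  refine (h1.prodMk h2).mono ?_
  rintro x ⟨hx1, hx2⟩
  exact ⟨⟨hx1, hx2.1⟩, ⟨hx1, hx2.2⟩⟩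

end Manifold

/-! ### Lie groups -/

section LieGroup

variable (E : Type u) [AddCommGroup E] [Module ℝ E] [TopologicalSpace E]

/-- `G` is a Lie group modelled on `E`. -/
class IsLCLieGroup (G : Type v) [TopologicalSpace G] [ChartedSpace E G] [Group G] : Prop
    extends IsLCManifold E G where
  smooth_mul : Smooth (ModelProd E E) E (fun p : G × G => p.1 * p.2)
  smooth_inv : Smooth E E (fun g : G => g⁻¹)

variable {G : Type v} [TopologicalSpace G] [ChartedSpace E G] [Group G]

/-- The left invariant vector field `x_l(g) = T_1(λ_g) x` on `G`, in the chart `e` at `1`: its value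
at the point `p = e g`. -/
noncomputable def leftField (G : Type v) [TopologicalSpace G] [ChartedSpace E G] [Group G]
    (x : E) (p : E) : E :=
  let e := chartAt E (1 : G)
  dirDeriv (localRep e e (fun g => e.symm p * g)) (localDom e e (fun g => e.symm p * g)) (e 1) x

/-- The Lie bracket on `T_1 G` (identified with `E` by the chart `e` at `1`), i.e. the value in `1`
of the Lie bracket `[X, Y] = dY(X) - dX(Y)` of the left invariant vector fields `X = x_l`,
`Y = y_l`. -/
noncomputable def lieBracket (G : Type v) [TopologicalSpace G] [ChartedSpace E G] [Group G]
    (x y : E) : E :=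
  let e := chartAt E (1 : G)
  dirDeriv (leftField E G y) e.target (e 1) x - dirDeriv (leftField E G x) e.target (e 1) y

end LieGroup

/-! ### Smooth curves on `I = [0,1]` and regular Lie groups -/

section Regular

/-- A curve on `[0,1]` as a function on `ℝ`; only its values on `[0,1]` are used. -/
noncomputable def extendPath {G : Type v} (γ : unitInterval → G) : ℝ → G := IccExtend zero_le_one γ

variable (E : Type u) [AddCommGroup E] [Module ℝ E] [TopologicalSpace E]

/-- Smooth curves `[0,1] → G`. -/
def SmoothPath {G : Type v} [TopologicalSpace G] [ChartedSpace E G] (γ : unitInterval → G) : Prop :=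
  Continuous γ ∧ ∀ e ∈ atlas E G,
    SmoothOn (fun t => e (extendPath γ t)) (Icc 0 1 ∩ extendPath γ ⁻¹' e.source)

/-- The derivative `γ'(t)` of a smooth curve, in `T_(γ t) G`. -/
noncomputable def pathDeriv {G : Type v} [TopologicalSpace G] [ChartedSpace E G]
    (γ : unitInterval → G) (t : unitInterval) : E :=
  let e := chartAt E (γ t)
  dirDeriv (fun s => e (extendPath γ s)) (Icc 0 1 ∩ extendPath γ ⁻¹' e.source) (t : ℝ) 1

variable [IsTopologicalAddGroup E] [ContinuousSMul ℝ E]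

/-- The vector space of smooth curves `[0,1] → E`. -/
noncomputable def smoothPaths : Submodule ℝ (unitInterval → E) where
  carrier := {ξ | SmoothOn (extendPath ξ) (Icc 0 1)}
  zero_mem' := fun _ => CnOn.const 0 _
  add_mem' := fun ha hb n => CnOn.linear_comp
    (ContinuousLinearMap.fst ℝ E E + ContinuousLinearMap.snd ℝ E E) ((ha n).prodMk (hb n))
  smul_mem' := fun c _ ha n => CnOn.linear_comp (c • ContinuousLinearMap.id ℝ E) (ha n)

/-- The locally convex space `C^∞([0,1], E)`. -/
def PathSpace : Type u := ↥(smoothPaths E)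

noncomputable instance : AddCommGroup (PathSpace E) := inferInstanceAs (AddCommGroup ↥(smoothPaths E))

noncomputable instance : Module ℝ (PathSpace E) := inferInstanceAs (Module ℝ ↥(smoothPaths E))

/-- The smooth compact open topology on `C^∞([0,1], E)`. -/
noncomputable instance : TopologicalSpace (PathSpace E) :=
  ⨅ k : ℕ, (tangentCompactOpen k (Icc (0 : ℝ) 1)).induced fun ξ => extendPath ξ.1

/-- `G` is a regular Lie group: for each `ξ ∈ C^∞([0,1], 𝔤)` the initial value problem `γ(0) = 1`,
`γ'(t) = T_1(λ_(γ t)) ξ(t)` has a solution `γ_ξ ∈ C^∞([0,1], G)` and the evolution map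
`C^∞([0,1], 𝔤) → G`, `ξ ↦ γ_ξ(1)` is smooth. -/
def IsRegular (G : Type v) [TopologicalSpace G] [ChartedSpace E G] [Group G] : Prop :=
  ∃ Evol : PathSpace E → unitInterval → G,
    (∀ ξ, SmoothPath E (Evol ξ) ∧ Evol ξ 0 = 1 ∧
      ∀ t, pathDeriv E (Evol ξ) t = tangentMapAt E E (fun g : G => Evol ξ t * g) 1 (ξ.1 t)) ∧
    Smooth (PathSpace E) E (fun ξ => Evol ξ 1)

end Regular

/-! ### The group `C^∞(M,K)` and the Lie algebra `C^∞(M,𝔨)` -/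

section MappingGroup

variable (F : Type u) [AddCommGroup F] [Module ℝ F] [TopologicalSpace F]
variable (M : Type u₁) [TopologicalSpace M] [ChartedSpace F M]

/-- The vector space of smooth maps `M → E`. -/
def smoothFunctions (E : Type v) [AddCommGroup E] [Module ℝ E] [TopologicalSpace E]
    [IsTopologicalAddGroup E] [ContinuousSMul ℝ E] : Submodule ℝ (M → E) where
  carrier := {f | Smooth F E f}
  zero_mem' := Smooth.const 0
  add_mem' := by
    rintro a b ⟨hac, ha⟩ ⟨hbc, hb⟩
    refine ⟨hac.add hbc, ?_⟩
    rintro e he e' rfl n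
    exact CnOn.linear_comp (ContinuousLinearMap.fst ℝ E E + ContinuousLinearMap.snd ℝ E E)
      ((ha e he _ rfl n).prodMk (hb e he _ rfl n))
  smul_mem' := by
    rintro c a ⟨hac, ha⟩
    refine ⟨hac.const_smul c, ?_⟩
    rintro e he e' rfl n
    exact CnOn.linear_comp (c • ContinuousLinearMap.id ℝ E) (ha e he _ rfl n)

/-- The locally convex space `C^∞(M, E)`. -/
def FunctionSpace (E : Type v) [AddCommGroup E] [Module ℝ E] [TopologicalSpace E]
    [IsTopologicalAddGroup E] [ContinuousSMul ℝ E] : Type (max u₁ v) := ↥(smoothFunctions F M E)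

section

variable (E : Type v) [AddCommGroup E] [Module ℝ E] [TopologicalSpace E]
  [IsTopologicalAddGroup E] [ContinuousSMul ℝ E]

noncomputable instance : AddCommGroup (FunctionSpace F M E) :=
  inferInstanceAs (AddCommGroup ↥(smoothFunctions F M E))

noncomputable instance : Module ℝ (FunctionSpace F M E) :=
  inferInstanceAs (Module ℝ ↥(smoothFunctions F M E))

/-- The smooth compact open topology on `C^∞(M, E)`, `M` finite-dimensional: the topology of uniform
convergence on compact sets of all iterated tangent maps `T^k f`, expressed in the charts of `M`. -/
noncomputable instance : TopologicalSpace (FunctionSpace F M E) :=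
  ⨅ e ∈ atlas F M, ⨅ k : ℕ, (tangentCompactOpen k e.target).induced fun f x => f.1 (e.symm x)

end

variable [IsTopologicalAddGroup F] [ContinuousSMul ℝ F]
variable (E : Type v) [AddCommGroup E] [Module ℝ E] [TopologicalSpace E]
  [IsTopologicalAddGroup E] [ContinuousSMul ℝ E] [LocallyConvexSpace ℝ E] [T2Space E]
variable (K : Type u₂) [TopologicalSpace K] [ChartedSpace E K] [Group K] [IsLCLieGroup E K]

instance : IsTopologicalAddGroup (ModelProd E E) := inferInstanceAs (IsTopologicalAddGroup (E × E))

instance : ContinuousSMul ℝ (ModelProd E E) := inferInstanceAs (ContinuousSMul ℝ (E × E))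

/-- The group of smooth maps `M → K` under pointwise multiplication. -/
def smoothMaps : Subgroup (M → K) where
  carrier := {f | Smooth F E f}
  one_mem' := Smooth.const 1
  mul_mem' := fun hf hg => (IsLCLieGroup.smooth_mul (E := E) (G := K)).comp (hf.prodMk hg)
  inv_mem' := fun hf => (IsLCLieGroup.smooth_inv (E := E) (G := K)).comp hf

/-- The group `C^∞(M, K)` (without a topology). -/
def MappingGroup : Type (max u₁ u₂) := ↥(smoothMaps F M E K)

noncomputable instance : Group (MappingGroup F M E K) := inferInstanceAs (Group ↥(smoothMaps F M E K))

end MappingGroup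

/-! ### Lie group structures on a given group -/

/-- A Lie group structure on the group `G`, modelled on `E`. -/
structure LieGroupStructure (E : Type u) [AddCommGroup E] [Module ℝ E] [TopologicalSpace E]
    (G : Type v) [Group G] where
  top : TopologicalSpace G
  charts : ChartedSpace E G
  isLie : IsLCLieGroup E G

namespace LieGroupStructure

variable {E : Type u} [AddCommGroup E] [Module ℝ E] [TopologicalSpace E]
variable {E' : Type w} [AddCommGroup E'] [Module ℝ E'] [TopologicalSpace E']
variable {G : Type v} [Group G]

/-- The group `G`, regarded as a Lie group by means of the structure `S`. -/
def Space (_S : LieGroupStructure E G) : Type v := G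

instance (S : LieGroupStructure E G) : Group S.Space := inferInstanceAs (Group G)

instance (S : LieGroupStructure E G) : TopologicalSpace S.Space := S.top

instance (S : LieGroupStructure E G) : ChartedSpace E S.Space := S.charts

instance (S : LieGroupStructure E G) : IsLCLieGroup E S.Space := S.isLie

/-- The identity of `G`, as a map between the Lie groups given by `S` and `S'`. -/
def idMap (S : LieGroupStructure E G) (S' : LieGroupStructure E' G) : S.Space → S'.Space :=
  fun g => g

/-- `S` and `S'` are the same Lie group structure on `G`: the identity of `G` is a diffeomorphism,
i.e. the topologies agree and the charts of `S` are smoothly compatible with those of `S'`. -/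
def Same (S : LieGroupStructure E G) (S' : LieGroupStructure E' G) : Prop :=
  Smooth E E' (S.idMap S') ∧ Smooth E' E (S'.idMap S)

end LieGroupStructure

section Compatible

variable {F : Type u} [AddCommGroup F] [Module ℝ F] [TopologicalSpace F]
  [IsTopologicalAddGroup F] [ContinuousSMul ℝ F]
variable {M : Type u₁} [TopologicalSpace M] [ChartedSpace F M]
variable {E : Type v} [AddCommGroup E] [Module ℝ E] [TopologicalSpace E]
  [IsTopologicalAddGroup E] [ContinuousSMul ℝ E] [LocallyConvexSpace ℝ E] [T2Space E]
variable {K : Type u₂} [TopologicalSpace K] [ChartedSpace E K] [Group K] [IsLCLieGroup E K]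
variable {E' : Type w} [AddCommGroup E'] [Module ℝ E'] [TopologicalSpace E']

/-- The evaluation `ev_m : C^∞(M,K) → K`, `f ↦ f m`. -/
def evalAt (S : LieGroupStructure E' (MappingGroup F M E K)) (m : M) : S.Space → K :=
  fun f => Subtype.val (p := (· ∈ smoothMaps F M E K)) f m

/-- The Lie group structure `S` on `C^∞(M,K)` is compatible with evaluations: its Lie algebra is
`C^∞(M,𝔨)` with the pointwise bracket (by an isomorphism `θ` of topological Lie algebras), all
evaluations `ev_m` are smooth, and `L(ev_m) = ev_m`. -/
def CompatibleWithEvaluations (S : LieGroupStructure E' (MappingGroup F M E K)) : Prop :=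
  (∀ m, Smooth E' E (evalAt S m)) ∧
  ∃ θ : E' ≃L[ℝ] FunctionSpace F M E,
    (∀ x y m, (θ (lieBracket E' S.Space x y)).1 m = lieBracket E K ((θ x).1 m) ((θ y).1 m)) ∧
    ∀ m x, tangentMapAt E' E (evalAt S m) 1 x = (θ x).1 m

end Compatible

end LCCalculus

/-!
Let `G₁`, `G₂` be the two Lie groups, and `e` the chart of `G₁` at `1`. For `p` near `e 1`, the
segment from `e 1` to `p` is a curve in `G₁` from `1` to `e⁻¹ p` whose left logarithmic derivative
at time `t` depends smoothly on `(p, t)`. By the exponential law this gives a smooth map from a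
neighbourhood of `e 1` to `C^∞([0,1], L(G₂))`, where `L(G₁)` and `L(G₂)` are identified by way of
`C^∞(M,𝔨)`, and following it by the smooth evolution map of the regular Lie group `G₂` we get a
smooth map into `G₂`. For each `m`, the evaluation `ev_m` takes the segment in `G₁` and the
evolution in `G₂` to curves in `K` that start at `1` and have the same logarithmic derivative, so
that these curves are equal; as the evaluations separate points, the smooth map into `G₂` is `e⁻¹`.
So the identity map `G₁ → G₂` is smooth near `1`, and smooth since it is a homomorphism.

The topology of `C^∞([0,1], E)` controls iterated tangent maps, in which the order of
differentiation matters; the exponential law therefore rests on the symmetry of second derivatives.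
-/

namespace LCCalculus

open Set Filter Topology

universe u v w u₁ u₂ u₃

section Calculus

variable {X : Type u} [AddCommGroup X] [Module ℝ X]
variable {Y : Type v} [AddCommGroup Y] [Module ℝ Y] [TopologicalSpace Y]
variable {Z : Type w} [AddCommGroup Z] [Module ℝ Z]

/-- The punctured filters along which the directional derivatives of maps on `U` are taken are
proper, so that these derivatives are unique. This holds for open sets and for `[0,1]`. -/
def AdmitsDirections (U : Set X) : Prop :=
  ∀ x ∈ U, ∀ h, (𝓝[{t : ℝ | t ≠ 0 ∧ x + t • h ∈ U}] (0 : ℝ)).NeBot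

theorem AdmitsDirections.prod_univ {U : Set X} (hU : AdmitsDirections U) :
    AdmitsDirections (U ×ˢ (univ : Set Z)) := by
  rintro ⟨x, y⟩ ⟨hx, -⟩ ⟨h, k⟩
  simpa using hU x hx h

theorem AdmitsDirections.of_isOpen [TopologicalSpace X] [IsTopologicalAddGroup X]
    [ContinuousSMul ℝ X] {U : Set X} (hU : IsOpen U) :
    AdmitsDirections U := fun _ hx h => dir_neBot hU hx h

theorem AdmitsDirections.inter_isOpen [TopologicalSpace X] [IsTopologicalAddGroup X]
    [ContinuousSMul ℝ X] {U V : Set X} (hU : AdmitsDirections U) (hV : IsOpen V) :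
    AdmitsDirections (U ∩ V) := by
  rintro x ⟨hxU, hxV⟩ h
  have hline : Continuous fun t : ℝ => x + t • h := by fun_prop
  have hmem : (fun t : ℝ => x + t • h) ⁻¹' V ∈ 𝓝 (0 : ℝ) :=
    hline.continuousAt (hV.mem_nhds (by simpa using hxV))
  have hinter : {t : ℝ | t ≠ 0 ∧ x + t • h ∈ U ∩ V} =
      {t : ℝ | t ≠ 0 ∧ x + t • h ∈ U} ∩ (fun t : ℝ => x + t • h) ⁻¹' V := by
    ext t
    simp [and_assoc]
  rw [hinter, nhdsWithin_inter_of_mem' (nhdsWithin_le_nhds hmem)]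
  exact hU x hxU h

theorem AdmitsDirections.of_convex {I : Set ℝ} (hI : Convex ℝ I) (hI' : I.Nontrivial) :
    AdmitsDirections I := by
  intro x hx h
  obtain ⟨c, hc, hxc⟩ : ∃ c : ℝ, c ≠ 0 ∧ x + c * h ∈ I := by
    obtain ⟨y, hy, hyx⟩ := hI'.exists_ne x
    rcases eq_or_ne h 0 with rfl | hh
    · exact ⟨1, one_ne_zero, by simpa using hx⟩
    · exact ⟨(y - x) / h, div_ne_zero (sub_ne_zero.2 hyx) hh, by simpa [hh] using hy⟩
  have hscale : Tendsto (fun s : ℝ => s * c) (𝓝[>] 0) (𝓝[{t : ℝ | t ≠ 0 ∧ x + t • h ∈ I}] 0) := by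
    refine tendsto_nhdsWithin_iff.2 ⟨?_, ?_⟩
    · simpa using ((continuous_mul_const c).tendsto 0).mono_left nhdsWithin_le_nhds
    · filter_upwards [Ioo_mem_nhdsGT (zero_lt_one (α := ℝ))] with s hs
      refine ⟨mul_ne_zero hs.1.ne' hc, ?_⟩
      convert hI hx hxc (sub_nonneg.2 hs.2.le) hs.1.le (by ring) using 1
      simp only [smul_eq_mul]
      ring
  exact hscale.neBot

theorem admitsDirections_Icc : AdmitsDirections (Icc (0 : ℝ) 1) :=
  .of_convex (convex_Icc 0 1) (⟨0, by simp, 1, by simp, zero_ne_one⟩)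

namespace HasDirDeriv

variable {f g : X → Y} {U : Set X} {x h : X} {y z : Y}

theorem unique [T2Space Y] (hy : HasDirDeriv f U x h y) (hz : HasDirDeriv f U x h z)
    (hU : AdmitsDirections U) (hx : x ∈ U) : y = z :=
  have := hU x hx h
  tendsto_nhds_unique hy hz

theorem dirDeriv_eq [T2Space Y] (hf : HasDirDeriv f U x h y) (hU : AdmitsDirections U)
    (hx : x ∈ U) : dirDeriv f U x h = y :=
  have := hU x hx h
  Tendsto.limUnder_eq hf

theorem prodMk [TopologicalSpace Z] {g : X → Z} {z : Z} (hf : HasDirDeriv f U x h y)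
    (hg : HasDirDeriv g U x h z) : HasDirDeriv (fun x => (f x, g x)) U x h (y, z) :=
  Tendsto.prodMk_nhds hf hg

theorem add [ContinuousAdd Y] (hf : HasDirDeriv f U x h y) (hg : HasDirDeriv g U x h z) :
    HasDirDeriv (f + g) U x h (y + z) := by
  refine (Tendsto.add hf hg).congr fun t => ?_
  simp only [Pi.add_apply, ← smul_add, add_sub_add_comm]

theorem sub [IsTopologicalAddGroup Y] (hf : HasDirDeriv f U x h y) (hg : HasDirDeriv g U x h z) :
    HasDirDeriv (f - g) U x h (y - z) := by
  refine (Tendsto.sub hf hg).congr fun t => ?_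
  simp only [Pi.sub_apply, ← smul_sub, sub_sub_sub_comm]

theorem const_smul [ContinuousConstSMul ℝ Y] (hf : HasDirDeriv f U x h y) (c : ℝ) :
    HasDirDeriv (c • f) U x h (c • y) := by
  refine (Tendsto.const_smul hf c).congr fun t => ?_
  simp only [Pi.smul_apply, ← smul_sub, smul_comm c]

theorem smul [ContinuousAdd Y] [ContinuousSMul ℝ Y] {a : X → ℝ} {a' : ℝ}
    (ha : HasDirDeriv a U x h a') (hf : HasDirDeriv f U x h y) :
    HasDirDeriv (fun x => a x • f x) U x h (a' • f x + a x • y) := by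
  have hline : Tendsto (fun t : ℝ => t) (𝓝[{t : ℝ | t ≠ 0 ∧ x + t • h ∈ U}] 0) (𝓝 0) :=
    tendsto_id.mono_left nhdsWithin_le_nhds
  have hf₀ := (hline.smul hf).add_const (f x)
  rw [zero_smul, zero_add] at hf₀
  refine ((Tendsto.smul ha hf₀).add (Tendsto.const_smul hf (a x))).congr' ?_
  filter_upwards [self_mem_nhdsWithin] with t ht
  rw [smul_inv_smul₀ ht.1, sub_add_cancel, smul_eq_mul, mul_smul, smul_comm (a x) t⁻¹,
    ← smul_add, sub_smul, smul_sub, sub_add_sub_cancel]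

theorem const (c : Y) (U : Set X) (x h : X) : HasDirDeriv (fun _ => c) U x h 0 := by
  simpa only [HasDirDeriv, sub_self, smul_zero] using tendsto_const_nhds

theorem linearMap (L : X →ₗ[ℝ] Y) (U : Set X) (x h : X) : HasDirDeriv L U x h (L h) := by
  refine tendsto_const_nhds.congr' ?_
  filter_upwards [self_mem_nhdsWithin] with t ht
  rw [map_add, map_smul, add_sub_cancel_left, inv_smul_smul₀ ht.1]

theorem clm_comp [TopologicalSpace Z] (L : Y →L[ℝ] Z) (hf : HasDirDeriv f U x h y) :
    HasDirDeriv (fun x => L (f x)) U x h (L y) := by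
  refine ((L.continuous.tendsto y).comp hf).congr fun t => ?_
  simp only [Function.comp_apply, map_smul, map_sub]

theorem comp_line {φ : Z → X} {O : Set Z} {w k : Z} (hf : HasDirDeriv f U (φ w) h y)
    (hφ : ∀ t : ℝ, φ (w + t • k) = φ w + t • h) (hO : MapsTo φ O U) :
    HasDirDeriv (fun w => f (φ w)) O w k y := by
  simp only [HasDirDeriv, hφ]
  exact hf.mono_left (nhdsWithin_mono _ fun t ht => ⟨ht.1, hφ t ▸ hO ht.2⟩)

theorem hasDerivWithinAt {F : Type*} [NormedAddCommGroup F] [NormedSpace ℝ F] {f : ℝ → F}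
    {I : Set ℝ} {t : ℝ} {y : F} (hf : HasDirDeriv f I t 1 y) : HasDerivWithinAt f y I t := by
  rw [hasDerivWithinAt_iff_tendsto_slope]
  have hshift : Tendsto (fun s : ℝ => s - t) (𝓝[I \ {t}] t)
      (𝓝[{r : ℝ | r ≠ 0 ∧ t + r • (1 : ℝ) ∈ I}] 0) := by
    refine tendsto_nhdsWithin_iff.2 ⟨?_, ?_⟩
    · have hsub := (continuous_sub_right t).tendsto t
      rw [sub_self] at hsub
      exact hsub.mono_left nhdsWithin_le_nhds
    · filter_upwards [self_mem_nhdsWithin] with s hs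
      exact ⟨sub_ne_zero.2 hs.2, by simpa using hs.1⟩
  refine (Tendsto.comp hf hshift).congr fun s => ?_
  simp [slope_def_module]

end HasDirDeriv

variable [TopologicalSpace X]

theorem CnOn.hasDirDeriv [T2Space Y] {n : ℕ} {f : X → Y} {U : Set X} (hf : CnOn (n + 1) f U)
    (hU : AdmitsDirections U) {x : X} (hx : x ∈ U) (h : X) :
    HasDirDeriv f U x h (dirDeriv f U x h) := by
  obtain ⟨-, df, hdf, -⟩ := hf
  rw [(hdf x hx h).dirDeriv_eq hU hx]
  exact hdf x hx h

namespace SmoothOn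

variable [T2Space Y] {f : X → Y} {U : Set X}

theorem exists_deriv (hf : SmoothOn f U) (hU : AdmitsDirections U) : ∃ df : X × X → Y,
    (∀ x ∈ U, ∀ h, HasDirDeriv f U x h (df (x, h))) ∧ SmoothOn df (U ×ˢ univ) := by
  obtain ⟨-, df, hdf, -⟩ := hf 1
  refine ⟨df, hdf, fun n => ?_⟩
  obtain ⟨-, df', hdf', hsmooth⟩ := hf (n + 1)
  exact hsmooth.congr fun z hz => (hdf' z.1 hz.1 z.2).unique (hdf z.1 hz.1 z.2) hU hz.1

theorem hasDirDeriv (hf : SmoothOn f U) (hU : AdmitsDirections U) {x : X} (hx : x ∈ U) (h : X) :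
    HasDirDeriv f U x h (dirDeriv f U x h) :=
  (hf 1).hasDirDeriv hU hx h

theorem dirDeriv (hf : SmoothOn f U) (hU : AdmitsDirections U) :
    SmoothOn (fun z : X × X => LCCalculus.dirDeriv f U z.1 z.2) (U ×ˢ univ) := by
  obtain ⟨df, hdf, hsmooth⟩ := hf.exists_deriv hU
  exact fun n => (hsmooth n).congr fun z hz => ((hdf z.1 hz.1 z.2).dirDeriv_eq hU hz.1).symm

end SmoothOn

end Calculus

namespace CnOn

variable {Y : Type v} [AddCommGroup Y] [Module ℝ Y] [TopologicalSpace Y] {n : ℕ}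

theorem comp_fst {X : Type u} [AddCommGroup X] [Module ℝ X] [TopologicalSpace X]
    {Z : Type w} [AddCommGroup Z] [Module ℝ Z] [TopologicalSpace Z] {f : X → Y} {U : Set X}
    (hf : CnOn n f U) (V : Set Z) : CnOn n (fun z : X × Z => f z.1) (U ×ˢ V) :=
  (hf.comp_linear (ContinuousLinearMap.fst ℝ X Z)).mono fun _ hz => hz.1

theorem add [ContinuousAdd Y] {X : Type u} [AddCommGroup X] [Module ℝ X] [TopologicalSpace X]
    {f g : X → Y} {U : Set X} (hf : CnOn n f U) (hg : CnOn n g U) :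
    CnOn n (fun x => f x + g x) U :=
  CnOn.linear_comp (ContinuousLinearMap.fst ℝ Y Y + ContinuousLinearMap.snd ℝ Y Y) (hf.prodMk hg)

theorem smul [ContinuousAdd Y] [ContinuousSMul ℝ Y] :
    ∀ {X : Type u} [AddCommGroup X] [Module ℝ X] [TopologicalSpace X] {a : X → ℝ} {f : X → Y}
    {U : Set X}, CnOn n a U → CnOn n f U → CnOn n (fun x => a x • f x) U := by
  induction n with
  | zero => exact fun ha hf => ContinuousOn.smul ha hf
  | succ n ih =>
    intro X _ _ _ a f U ha hf
    have ha₁ := ha.of_succ.comp_fst (univ : Set X)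
    have hf₁ := hf.of_succ.comp_fst (univ : Set X)
    obtain ⟨hac, da, hda, ha'⟩ := ha
    obtain ⟨hfc, df, hdf, hf'⟩ := hf
    exact ⟨hac.smul hfc, fun z => da z • f z.1 + a z.1 • df z,
      fun x hx h => (hda x hx h).smul (hdf x hx h), (ih ha' hf₁).add (ih ha₁ hf')⟩

theorem continuousLinearMap : ∀ {X : Type u} [AddCommGroup X] [Module ℝ X] [TopologicalSpace X]
    (L : X →L[ℝ] Y) (U : Set X), CnOn n L U := by
  induction n with
  | zero => exact fun L U => L.continuous.continuousOn
  | succ n ih =>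
    intro X _ _ _ L U
    exact ⟨L.continuous.continuousOn, fun z => L z.2,
      fun x _ h => HasDirDeriv.linearMap L.toLinearMap U x h,
      ih (L.comp (ContinuousLinearMap.snd ℝ X X)) _⟩

end CnOn

section MeanValue

variable {Y : Type v} [AddCommGroup Y] [Module ℝ Y] [TopologicalSpace Y]
  [IsTopologicalAddGroup Y] [ContinuousSMul ℝ Y]
variable {Z : Type w} [AddCommGroup Z] [Module ℝ Z] [TopologicalSpace Z]
  [IsTopologicalAddGroup Z] [ContinuousSMul ℝ Z] [LocallyConvexSpace ℝ Z]

theorem exists_isClosed_convex_subset {z : Z} {N : Set Z} (hN : N ∈ 𝓝 z) :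
    ∃ C ∈ 𝓝 z, IsClosed C ∧ Convex ℝ C ∧ C ⊆ N := by
  obtain ⟨N', ⟨hN', hclosed⟩, hN'N⟩ := (closed_nhds_basis z).mem_iff.1 hN
  obtain ⟨C, ⟨hC, hconvex⟩, hCN'⟩ :=
    (LocallyConvexSpace.convex_basis (𝕜 := ℝ) z).mem_iff.1 hN'
  exact ⟨closure C, mem_of_superset hC subset_closure, isClosed_closure, hconvex.closure,
    (closure_minimal hCN' hclosed).trans hN'N⟩

theorem eventually_diffQuotient_mem {g : Y → Z} {V : Set Y} {dg : Y × Y → Z} (hV : IsOpen V)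
    (hg : ∀ y ∈ V, ∀ k, HasDirDeriv g V y k (dg (y, k))) (hdg : ContinuousOn dg (V ×ˢ univ))
    {y k : Y} (hy : y ∈ V) {N : Set Z} (hN : N ∈ 𝓝 (dg (y, k))) :
    ∀ᶠ z : ℝ × Y in 𝓝 (0, y), z.1 ≠ 0 → z.1⁻¹ • (g (z.2 + z.1 • k) - g z.2) ∈ N := by
  obtain ⟨C, hC, hclosed, hconvex, hCN⟩ := exists_isClosed_convex_subset hN
  have hdgC : ∀ᶠ z in 𝓝 y, z ∈ V ∧ dg (z, k) ∈ C := by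
    have hcont : ContinuousAt (fun z => dg (z, k)) y :=
      (hdg.continuousAt ((hV.prod isOpen_univ).mem_nhds ⟨hy, trivial⟩)).comp (f := fun z => (z, k))
        (by fun_prop)
    exact (show ∀ᶠ z in 𝓝 y, z ∈ V from hV.mem_nhds hy).and (hcont hC)
  have hsegment : ∀ᶠ z : ℝ × Y in 𝓝 (0, y), ∀ s ∈ Icc (0 : ℝ) 1,
      z.2 + (s * z.1) • k ∈ V ∧ dg (z.2 + (s * z.1) • k, k) ∈ C := by
    refine isCompact_Icc.eventually_forall_of_forall_eventually fun s _ => ?_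
    have hline : Continuous fun q : (ℝ × Y) × ℝ => q.1.2 + (q.2 * q.1.1) • k := by fun_prop
    have hlim : Tendsto (fun q : (ℝ × Y) × ℝ => q.1.2 + (q.2 * q.1.1) • k) (𝓝 ((0, y), s))
        (𝓝 y) := by
      simpa using hline.tendsto ((0, y), s)
    exact hlim.eventually hdgC
  filter_upwards [hsegment] with z hz hz₀
  exact hCN (segment_mem hV hg hconvex hclosed hz₀ hz)

end MeanValue

section Symmetry

open ContinuousLinearMap in
theorem HasDirDeriv.hasStrictFDerivAt {O : Set (ℝ × ℝ)} (hO : IsOpen O) {u : ℝ × ℝ → ℝ}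
    {du : (ℝ × ℝ) × (ℝ × ℝ) → ℝ} (hu : ∀ z ∈ O, ∀ w, HasDirDeriv u O z w (du (z, w)))
    (hdu : ContinuousOn du (O ×ˢ univ)) {z : ℝ × ℝ} (hz : z ∈ O) :
    HasStrictFDerivAt u (du (z, (1, 0)) • fst ℝ ℝ ℝ + du (z, (0, 1)) • snd ℝ ℝ ℝ) z := by
  have hdu' (w : ℝ × ℝ) : ContinuousAt (fun z => toSpanSingleton ℝ (du (z, w))) z := by
    have hduw := (hdu.continuousAt ((hO.prod isOpen_univ).mem_nhds ⟨hz, trivial⟩)).comp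
      (f := fun z => (z, w)) (by fun_prop)
    exact (toSpanSingletonCLE (𝕜 := ℝ)).continuous.continuousAt.comp hduw
  have hpartial : HasStrictFDerivAt u ((toSpanSingleton ℝ (du (z, (1, 0)))).coprod
      (toSpanSingleton ℝ (du (z, (0, 1))))) z := by
    refine hasStrictFDerivAt_uncurry_coprod (f := fun a b => u (a, b))
      (f₁ := fun a b => toSpanSingleton ℝ (du ((a, b), (1, 0))))
      (f₂ := fun a b => toSpanSingleton ℝ (du ((a, b), (0, 1)))) ?_ ?_ (hdu' _) (hdu' _)
    · filter_upwards [hO.mem_nhds hz] with y hy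
      have hslice : (fun s => (s, y.2)) ⁻¹' O ∈ 𝓝 y.1 :=
        (hO.preimage (by fun_prop)).mem_nhds hy
      exact ((hu y hy (1, 0)).comp_line (φ := fun s : ℝ => (s, y.2)) (k := 1)
        (by simp [Prod.ext_iff]) (mapsTo_preimage _ _)).hasDerivWithinAt.hasDerivAt hslice
    · filter_upwards [hO.mem_nhds hz] with y hy
      have hslice : (fun s => (y.1, s)) ⁻¹' O ∈ 𝓝 y.2 :=
        (hO.preimage (by fun_prop)).mem_nhds hy
      exact ((hu y hy (0, 1)).comp_line (φ := fun s : ℝ => (y.1, s)) (k := 1)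
        (by simp [Prod.ext_iff]) (mapsTo_preimage _ _)).hasDerivWithinAt.hasDerivAt hslice
  convert hpartial using 1
  ext <;> simp

theorem HasDirDeriv.mixed_partials_eq {O : Set (ℝ × ℝ)} (hO : IsOpen O) {u : ℝ × ℝ → ℝ}
    {du : (ℝ × ℝ) × (ℝ × ℝ) → ℝ} {ddu : ((ℝ × ℝ) × (ℝ × ℝ)) × ((ℝ × ℝ) × (ℝ × ℝ)) → ℝ}
    (hu : ∀ z ∈ O, ∀ w, HasDirDeriv u O z w (du (z, w)))
    (hdu : ∀ z ∈ O ×ˢ univ, ∀ w, HasDirDeriv du (O ×ˢ univ) z w (ddu (z, w)))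
    (hcont : ContinuousOn du (O ×ˢ univ)) (hcont' : ContinuousOn ddu ((O ×ˢ univ) ×ˢ univ))
    {z : ℝ × ℝ} (hz : z ∈ O) :
    ddu ((z, (1, 0)), ((0, 1), 0)) = ddu ((z, (0, 1)), ((1, 0), 0)) := by
  have hsecond (w : ℝ × ℝ) := hasStrictFDerivAt hO (u := fun z => du (z, w))
    (du := fun q => ddu ((q.1, w), (q.2, 0)))
    (fun y hy v => (hdu (y, w) ⟨hy, trivial⟩ (v, 0)).comp_line (φ := fun y => (y, w)) (by simp)
      fun y hy => ⟨hy, trivial⟩)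
    (hcont'.comp (by fun_prop) fun q hq => ⟨⟨hq.1, trivial⟩, trivial⟩) hz
  have hfirst : ∀ᶠ y in 𝓝 z, HasFDerivAt u
      (du (y, (1, 0)) • ContinuousLinearMap.fst ℝ ℝ ℝ +
        du (y, (0, 1)) • ContinuousLinearMap.snd ℝ ℝ ℝ) y := by
    filter_upwards [hO.mem_nhds hz] with y hy using (hasStrictFDerivAt hO hu hcont hy).hasFDerivAt
  have hsymm := second_derivative_symmetric_of_eventually_of_real hfirst
    (((hsecond (1, 0)).hasFDerivAt.smul_const (ContinuousLinearMap.fst ℝ ℝ ℝ)).fun_add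
      ((hsecond (0, 1)).hasFDerivAt.smul_const (ContinuousLinearMap.snd ℝ ℝ ℝ)))
    (0, 1) (1, 0)
  simpa using hsymm

theorem HasDirDeriv.symmetric {X : Type u} [AddCommGroup X] [Module ℝ X] [TopologicalSpace X]
    [IsTopologicalAddGroup X] [ContinuousSMul ℝ X] {Y : Type v} [AddCommGroup Y] [Module ℝ Y]
    [TopologicalSpace Y] [IsTopologicalAddGroup Y] [ContinuousSMul ℝ Y] [LocallyConvexSpace ℝ Y]
    [T2Space Y] {f : X → Y} {U : Set X} (hU : IsOpen U)
    {df : X × X → Y} {ddf : (X × X) × (X × X) → Y}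
    (hf : ∀ x ∈ U, ∀ h, HasDirDeriv f U x h (df (x, h)))
    (hdf : ∀ z ∈ U ×ˢ (univ : Set X), ∀ k, HasDirDeriv df (U ×ˢ univ) z k (ddf (z, k)))
    (hcont : ContinuousOn df (U ×ˢ univ)) (hcont' : ContinuousOn ddf ((U ×ˢ univ) ×ˢ univ))
    {x : X} (hx : x ∈ U) (h k : X) :
    ddf ((x, h), (k, 0)) = ddf ((x, k), (h, 0)) := by
  by_contra hne
  obtain ⟨l, hl⟩ := geometric_hahn_banach_point_point hne
  let L : ℝ × ℝ → X := fun z => z.1 • h + z.2 • k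
  have hL : Continuous L := by fun_prop
  have hL' (z w : ℝ × ℝ) (t : ℝ) : L (z + t • w) = L z + t • L w := by
    simp only [L, Prod.fst_add, Prod.snd_add, Prod.smul_fst, Prod.smul_snd, smul_eq_mul, add_smul,
      mul_smul, smul_add]
    abel
  have hplane := mixed_partials_eq (O := (fun z => x + L z) ⁻¹' U)
    (u := fun z => l (f (x + L z))) (du := fun z => l (df (x + L z.1, L z.2)))
    (ddu := fun z => l (ddf ((x + L z.1.1, L z.1.2), (L z.2.1, L z.2.2))))
    (hU.preimage (by fun_prop))
    (fun z hz w => ((hf _ hz (L w)).comp_line (φ := fun z => x + L z)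
      (by simp [hL', add_assoc]) (mapsTo_preimage _ _)).clm_comp l)
    (fun z hz w => ((hdf (x + L z.1, L z.2) ⟨hz.1, trivial⟩ (L w.1, L w.2)).comp_line
      (φ := fun z : (ℝ × ℝ) × (ℝ × ℝ) => (x + L z.1, L z.2)) (by simp [hL', add_assoc])
      fun z hz => ⟨hz.1, trivial⟩).clm_comp l)
    (l.continuous.comp_continuousOn (hcont.comp (by fun_prop) fun z hz => ⟨hz.1, trivial⟩))
    (l.continuous.comp_continuousOn
      (hcont'.comp (by fun_prop) fun z hz => ⟨⟨hz.1.1, trivial⟩, trivial⟩))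
    (z := 0) (by simpa [L] using hx)
  exact hl.ne (by simpa [L] using hplane)

end Symmetry

section ParameterDependence

variable {P : Type w} [AddCommGroup P] [Module ℝ P]
variable {X : Type u} [AddCommGroup X] [Module ℝ X]
variable {Y : Type v} [AddCommGroup Y] [Module ℝ Y] [TopologicalSpace Y]

/-- The tangent maps of the partial maps `Φ (p, ·)` of a map `Φ` with derivative `D`, as a map of
the parameter `p` and of the tangent vector `(x, h)`. -/
def partialTangent (Φ : P × X → Y) (D : (P × X) × (P × X) → Y) : P × (X × X) → Y × Y :=
  fun z => (Φ (z.1, z.2.1), D ((z.1, z.2.1), (0, z.2.2)))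

theorem CnOn.partialTangent [TopologicalSpace P] [TopologicalSpace X] {n : ℕ} {Φ : P × X → Y}
    {Ω : Set (P × X)} {D : (P × X) × (P × X) → Y} (hΦ : CnOn n Φ Ω) (hD : CnOn n D (Ω ×ˢ univ)) :
    CnOn n (partialTangent Φ D) ((fun z : P × (X × X) => (z.1, z.2.1)) ⁻¹' Ω) := by
  let A : P × (X × X) →L[ℝ] P × X := (ContinuousLinearMap.fst ℝ P (X × X)).prod
    ((ContinuousLinearMap.fst ℝ X X).comp (ContinuousLinearMap.snd ℝ P (X × X)))
  let B : P × (X × X) →L[ℝ] P × X := (0 : P × (X × X) →L[ℝ] P).prod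
    ((ContinuousLinearMap.snd ℝ X X).comp (ContinuousLinearMap.snd ℝ P (X × X)))
  exact (hΦ.comp_linear A).prodMk ((hD.comp_linear (A.prod B)).mono fun z hz => ⟨hz, trivial⟩)

variable {Φ : P × X → Y} {Ω : Set (P × X)} {D : (P × X) × (P × X) → Y} {U : Set X} {p : P}

theorem HasDirDeriv.slice {x h : X} {y : Y} (hΦ : HasDirDeriv Φ Ω (p, x) (0, h) y)
    (hp : MapsTo (Prod.mk p) U Ω) : HasDirDeriv (fun x => Φ (p, x)) U x h y :=
  hΦ.comp_line (φ := Prod.mk p) (by simp) hp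

theorem tangentMap_eqOn_partialTangent [TopologicalSpace X] [T2Space Y] (hU : AdmitsDirections U)
    (hD : ∀ z ∈ Ω, ∀ h, HasDirDeriv Φ Ω z h (D (z, h))) (hp : MapsTo (Prod.mk p) U Ω) {f : X → Y}
    (hf : EqOn f (fun x => Φ (p, x)) U) :
    EqOn (tangentMap U f) (fun z => partialTangent Φ D (p, z)) (U ×ˢ univ) :=
  fun z hz => Prod.ext (hf hz.1)
    ((((hD _ (hp hz.1) (0, z.2)).slice hp).congr hz.1 hf.symm).dirDeriv_eq hU hz.1)

theorem tangentMap_eqOn_diffQuotient [TopologicalSpace X] [IsTopologicalAddGroup Y]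
    [ContinuousConstSMul ℝ Y] [T2Space Y] (hU : AdmitsDirections U)
    (hD : ∀ z ∈ Ω, ∀ h, HasDirDeriv Φ Ω z h (D (z, h))) {p' : P} (hp : MapsTo (Prod.mk p) U Ω)
    (hp' : MapsTo (Prod.mk p') U Ω) {c : ℝ} {f : X → Y}
    (hf : EqOn f (fun x => c • (Φ (p', x) - Φ (p, x))) U) :
    EqOn (tangentMap U f)
      (fun z => c • (partialTangent Φ D (p', z) - partialTangent Φ D (p, z))) (U ×ˢ univ) := by
  rintro ⟨x, h⟩ ⟨hx, -⟩
  have hslice := (((hD _ (hp' hx) (0, h)).slice hp').sub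
    ((hD _ (hp hx) (0, h)).slice hp)).const_smul c
  exact Prod.ext (hf hx) ((hslice.congr hx hf.symm).dirDeriv_eq hU hx)

theorem hasDirDeriv_partialTangent [TopologicalSpace P] [IsTopologicalAddGroup P]
    [ContinuousSMul ℝ P] [TopologicalSpace X] [IsTopologicalAddGroup X] [ContinuousSMul ℝ X]
    [IsTopologicalAddGroup Y] [ContinuousSMul ℝ Y] [LocallyConvexSpace ℝ Y] [T2Space Y]
    (hΩ : IsOpen Ω) (hU : AdmitsDirections U) (hD : ∀ z ∈ Ω, ∀ h, HasDirDeriv Φ Ω z h (D (z, h)))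
    (hD' : CnOn 1 D (Ω ×ˢ univ)) (hp : MapsTo (Prod.mk p) U Ω) {q : P} {g : X → Y}
    (hg : ∀ x ∈ U, HasDirDeriv Φ Ω (p, x) (q, 0) (g x)) {z : X × X} (hz : z ∈ U ×ˢ univ) :
    HasDirDeriv (partialTangent Φ D) ((fun z : P × (X × X) => (z.1, z.2.1)) ⁻¹' Ω) (p, z) (q, 0)
      (tangentMap U g z) := by
  obtain ⟨x, h⟩ := z
  have hx : x ∈ U := hz.1
  obtain ⟨hcont, DD, hDD, hcont'⟩ := hD'
  have hdg : dirDeriv g U x h = DD (((p, x), (q, 0)), ((0, h), 0)) := by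
    refine HasDirDeriv.dirDeriv_eq ?_ hU hx
    have hcross := (hDD ((p, x), (q, 0)) ⟨hp hx, trivial⟩ ((0, h), 0)).comp_line (O := U)
      (φ := fun x => ((p, x), (q, 0))) (k := h) (by simp) fun x hx => ⟨hp hx, trivial⟩
    exact hcross.congr hx fun x' hx' =>
      (hD _ (hp hx') _).unique (hg x' hx') (.of_isOpen hΩ) (hp hx')
  have hsymm := HasDirDeriv.symmetric hΩ hD hDD hcont hcont' (hp hx) (0, h) (q, 0)
  rw [tangentMap, hdg, ← hsymm]
  have hfst := (hg x hx).comp_line (w := (p, x, h)) (k := (q, 0))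
    (φ := fun z : P × (X × X) => (z.1, z.2.1)) (by simp) (mapsTo_preimage _ Ω)
  have hsnd := (hDD ((p, x), (0, h)) ⟨hp hx, trivial⟩ ((q, 0), 0)).comp_line (w := (p, x, h))
    (k := (q, 0)) (φ := fun z : P × (X × X) => ((z.1, z.2.1), ((0 : P), z.2.2))) (by simp)
    (O := (fun z : P × (X × X) => (z.1, z.2.1)) ⁻¹' Ω) fun z hz => ⟨hz, trivial⟩
  exact hfst.prodMk hsnd

end ParameterDependence

section TangentCompactOpen

variable {P : Type w} [AddCommGroup P] [Module ℝ P] [TopologicalSpace P]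

theorem tendsto_tangentCompactOpen_zero {X : Type u} [AddCommGroup X] [Module ℝ X]
    [TopologicalSpace X] {Y : Type v} [AddCommGroup Y] [Module ℝ Y] [TopologicalSpace Y]
    {A : Type*} [TopologicalSpace A] {U : Set X} {W : Set A} {a : A} {f : A → X → Y} {g : X → Y}
    (hfg : ∀ x ∈ U, ∀ V ∈ 𝓝 (g x), ∀ᶠ z in 𝓝 (a, x), z.1 ∈ W → z.2 ∈ U → f z.1 z.2 ∈ V) :
    Tendsto f (𝓝[W] a) (@nhds _ (tangentCompactOpen 0 U) g) := by
  rw [tangentCompactOpen, TopologicalSpace.tendsto_nhds_generateFrom_iff]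
  rintro _ ⟨C, V, hC, hCU, hV, rfl⟩ hgC
  have hev := hC.eventually_forall_of_forall_eventually
    (P := fun b x => b ∈ W → x ∈ U → f b x ∈ V) fun x hx =>
      hfg x (hCU hx) V (hV.mem_nhds (hgC hx))
  filter_upwards [self_mem_nhdsWithin, nhdsWithin_le_nhds hev] with b hb hb' x hx
  exact hb' x hx hb (hCU hx)

theorem tendsto_tangentCompactOpen_slice {n : ℕ} : ∀ {X : Type u} [AddCommGroup X] [Module ℝ X]
    [TopologicalSpace X] {Y : Type v} [AddCommGroup Y] [Module ℝ Y] [TopologicalSpace Y]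
    [T2Space Y] {Φ : P × X → Y} {Ω : Set (P × X)} {U : Set X} {W : Set P} {f : P → X → Y}
    {p : P}, IsOpen Ω → AdmitsDirections U → W ×ˢ U ⊆ Ω → CnOn n Φ Ω →
    (∀ q ∈ W, EqOn (f q) (fun x => Φ (q, x)) U) → p ∈ W →
    Tendsto f (𝓝[W] p) (@nhds _ (tangentCompactOpen n U) (f p)) := by
  induction n with
  | zero =>
    intro X _ _ _ Y _ _ _ _ Φ Ω U W f p hΩ _ hW hΦ hf hp
    refine tendsto_tangentCompactOpen_zero fun x hx V hV => ?_
    rw [hf p hp hx] at hV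
    filter_upwards [ContinuousOn.continuousAt hΦ (hΩ.mem_nhds (hW ⟨hp, hx⟩)) hV] with z hz hzW hzU
    rwa [hf z.1 hzW hzU]
  | succ n ih =>
    intro X _ _ _ Y _ _ _ _ Φ Ω U W f p hΩ hU hW hΦ hf hp
    have hΦ' := hΦ.of_succ
    obtain ⟨-, D, hD, hD'⟩ := hΦ
    rw [tangentCompactOpen, @nhds_induced _ _ (tangentCompactOpen n (U ×ˢ univ)), tendsto_comap_iff]
    exact ih (hΩ.preimage (by fun_prop)) hU.prod_univ (fun z hz => hW ⟨hz.1, hz.2.1⟩)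
      (hΦ'.partialTangent hD') (fun q hq => tangentMap_eqOn_partialTangent hU hD
        (fun x hx => hW ⟨hq, hx⟩) (hf q hq)) hp

theorem tendsto_tangentCompactOpen_diffQuotient [IsTopologicalAddGroup P] [ContinuousSMul ℝ P]
    {n : ℕ} : ∀ {X : Type u} [AddCommGroup X] [Module ℝ X]
    [TopologicalSpace X] [IsTopologicalAddGroup X] [ContinuousSMul ℝ X]
    {Y : Type v} [AddCommGroup Y] [Module ℝ Y] [TopologicalSpace Y]
    [IsTopologicalAddGroup Y] [ContinuousSMul ℝ Y] [LocallyConvexSpace ℝ Y] [T2Space Y]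
    {Φ : P × X → Y} {Ω : Set (P × X)} {U : Set X} {W : Set P} {f : ℝ → X → Y} {g : X → Y}
    {p q : P}, IsOpen Ω → AdmitsDirections U → W ×ˢ U ⊆ Ω → CnOn (n + 1) Φ Ω →
    (∀ t : ℝ, t ≠ 0 → p + t • q ∈ W →
      EqOn (f t) (fun x => t⁻¹ • (Φ (p + t • q, x) - Φ (p, x))) U) →
    (∀ x ∈ U, HasDirDeriv Φ Ω (p, x) (q, 0) (g x)) → p ∈ W →
    Tendsto f (𝓝[{t : ℝ | t ≠ 0 ∧ p + t • q ∈ W}] 0) (@nhds _ (tangentCompactOpen n U) g) := by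
  induction n with
  | zero =>
    intro X _ _ _ _ _ Y _ _ _ _ _ _ _ Φ Ω U W f g p q hΩ _ hW hΦ hf hg hp
    obtain ⟨-, D, hD, hD'⟩ := hΦ
    refine tendsto_tangentCompactOpen_zero fun x hx V hV => ?_
    have hpx : (p, x) ∈ Ω := hW ⟨hp, hx⟩
    rw [(hg x hx).unique (hD _ hpx _) (.of_isOpen hΩ) hpx] at hV
    have hline : Tendsto (fun z : ℝ × X => (z.1, (p, z.2))) (𝓝 (0, x)) (𝓝 (0, (p, x))) :=
      (by fun_prop : Continuous fun z : ℝ × X => (z.1, (p, z.2))).tendsto (0, x)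
    filter_upwards [hline.eventually (eventually_diffQuotient_mem hΩ hD hD' hpx hV)]
      with z hz ht hzU
    rw [hf z.1 ht.1 ht.2 hzU]
    simpa using hz ht.1
  | succ n ih =>
    intro X _ _ _ _ _ Y _ _ _ _ _ _ _ Φ Ω U W f g p q hΩ hU hW hΦ hf hg hp
    have hΦ' := hΦ.of_succ
    obtain ⟨-, D, hD, hD'⟩ := hΦ
    have hpU : MapsTo (Prod.mk p) U Ω := fun x hx => hW ⟨hp, hx⟩
    rw [tangentCompactOpen, @nhds_induced _ _ (tangentCompactOpen n (U ×ˢ univ)), tendsto_comap_iff]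
    have hD₁ : CnOn 1 D (Ω ×ˢ univ) := by
      obtain ⟨hcont, DD, hDD, hDD'⟩ := hD'
      exact ⟨hcont, DD, hDD, hDD'.continuousOn⟩
    exact ih (hΩ.preimage (by fun_prop)) hU.prod_univ (fun z hz => hW ⟨hz.1, hz.2.1⟩)
      (hΦ'.partialTangent hD') (fun t ht htW => tangentMap_eqOn_diffQuotient hU hD hpU
        (fun x hx => hW ⟨htW, hx⟩) (hf t ht htW))
      (fun z hz => hasDirDeriv_partialTangent hΩ hU hD hD₁ hpU hg hz) hp

end TangentCompactOpen

section VectorTopology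

theorem induced_tangentCompactOpen_zero {S : Type*} {X : Type u} [AddCommGroup X] [Module ℝ X]
    [TopologicalSpace X] {Y : Type v} [AddCommGroup Y] [Module ℝ Y] [TopologicalSpace Y]
    {U : Set X} {ι : S → X → Y} {J : S → C(U, Y)} (hJ : ∀ s x, J s x = ι s x) :
    (tangentCompactOpen 0 U).induced ι = ContinuousMap.compactOpen.induced J := by
  rw [tangentCompactOpen, ContinuousMap.compactOpen, induced_generateFrom_eq,
    induced_generateFrom_eq]
  congr 1
  ext s
  constructor
  · rintro ⟨_, ⟨C, V, hC, hCU, hV, rfl⟩, rfl⟩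
    have hC' : IsCompact (Subtype.val ⁻¹' C : Set U) :=
      IsInducing.subtypeVal.isCompact_preimage' hC (by simpa using hCU)
    refine ⟨_, ⟨Subtype.val ⁻¹' C, hC', V, hV, rfl⟩, ?_⟩
    ext a
    exact ⟨fun h x hx => hJ a ⟨x, hCU hx⟩ ▸ h (x := ⟨x, hCU hx⟩) hx,
      fun h x hx => (hJ a x).symm ▸ h hx⟩
  · rintro ⟨_, ⟨C, hC, V, hV, rfl⟩, rfl⟩
    refine ⟨_, ⟨Subtype.val '' C, V, hC.image continuous_subtype_val, by simp, hV, rfl⟩, ?_⟩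
    ext a
    refine (mapsTo_image_iff (f := ι a) (s := C)).trans ?_
    rw [show ι a ∘ Subtype.val = J a from funext fun x => (hJ a x).symm]
    rfl

section TangentMapLinear

variable {X : Type u} [AddCommGroup X] [Module ℝ X] [TopologicalSpace X]
variable {Y : Type v} [AddCommGroup Y] [Module ℝ Y] [TopologicalSpace Y] [T2Space Y]
variable {f g k : X → Y} {U : Set X}

theorem CnOn.tangentMap {n : ℕ} (hf : CnOn (n + 1) f U) (hU : AdmitsDirections U) :
    CnOn n (tangentMap U f) (U ×ˢ univ) := by
  have hf₁ := hf.of_succ.comp_fst (univ : Set X)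
  obtain ⟨-, df, hdf, hdf'⟩ := hf
  exact (hf₁.prodMk hdf').congr fun z hz =>
    Prod.ext rfl ((hdf z.1 hz.1 z.2).dirDeriv_eq hU hz.1).symm

theorem tangentMap_add_eqOn [ContinuousAdd Y] (hU : AdmitsDirections U)
    {n : ℕ} (hf : CnOn (n + 1) f U) (hg : CnOn (n + 1) g U) (hk : EqOn k (f + g) U) :
    EqOn (tangentMap U k) (tangentMap U f + tangentMap U g) (U ×ˢ univ) := fun z hz =>
  Prod.ext (hk hz.1) ((((hf.hasDirDeriv hU hz.1 z.2).add (hg.hasDirDeriv hU hz.1 z.2)).congr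
    hz.1 hk.symm).dirDeriv_eq hU hz.1)

theorem tangentMap_smul_eqOn [ContinuousConstSMul ℝ Y] (hU : AdmitsDirections U)
    {n : ℕ} (hf : CnOn (n + 1) f U) {c : ℝ} (hk : EqOn k (c • f) U) :
    EqOn (tangentMap U k) (c • tangentMap U f) (U ×ˢ univ) := fun z hz =>
  Prod.ext (hk hz.1) ((((hf.hasDirDeriv hU hz.1 z.2).const_smul c).congr
    hz.1 hk.symm).dirDeriv_eq hU hz.1)

end TangentMapLinear

theorem isTopologicalAddGroup_and_continuousSMul_induced_tangentCompactOpen {S : Type w}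
    [AddCommGroup S] [Module ℝ S] {n : ℕ} :
    ∀ {X : Type u} [AddCommGroup X] [Module ℝ X] [TopologicalSpace X]
    {Y : Type v} [AddCommGroup Y] [Module ℝ Y] [TopologicalSpace Y]
    [IsTopologicalAddGroup Y] [ContinuousSMul ℝ Y] [T2Space Y] {U : Set X} {ι : S → X → Y},
    AdmitsDirections U → (∀ s, CnOn n (ι s) U) → (∀ a b, EqOn (ι (a + b)) (ι a + ι b) U) →
    (∀ (c : ℝ) a, EqOn (ι (c • a)) (c • ι a) U) →
    @IsTopologicalAddGroup S ((tangentCompactOpen n U).induced ι) _ ∧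
      @ContinuousSMul ℝ S _ _ ((tangentCompactOpen n U).induced ι) := by
  induction n with
  | zero =>
    intro X _ _ _ Y _ _ _ _ _ _ U ι _ hι hadd hsmul
    let J : S →ₗ[ℝ] C(U, Y) :=
      { toFun := fun s => ⟨U.domRestrict (ι s), ContinuousOn.domRestrict (hι s)⟩
        map_add' := fun a b => by ext x; exact hadd a b x.2
        map_smul' := fun c a => by ext x; exact hsmul c a x.2 }
    rw [induced_tangentCompactOpen_zero (J := J) fun _ _ => rfl]
    exact ⟨topologicalAddGroup_induced J, continuousSMul_induced J⟩
  | succ n ih =>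
    intro X _ _ _ Y _ _ _ _ _ _ U ι hU hι hadd hsmul
    rw [tangentCompactOpen, induced_compose]
    exact ih hU.prod_univ (fun s => (hι s).tangentMap hU)
      (fun a b => tangentMap_add_eqOn hU (hι a) (hι b) (hadd a b))
      (fun c a => tangentMap_smul_eqOn hU (hι a) (hsmul c a))

end VectorTopology

theorem extendPath_apply {G : Type*} (γ : unitInterval → G) (t : unitInterval) :
    extendPath γ t = γ t :=
  IccExtend_val _ _ _

theorem extendPath_eqOn {G : Type*} {γ : unitInterval → G} {f : ℝ → G} (hγ : ∀ t, γ t = f t) :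
    EqOn (extendPath γ) f (Icc 0 1) :=
  fun t ht => (extendPath_apply γ ⟨t, ht⟩).trans (hγ ⟨t, ht⟩)

namespace PathSpace

variable {E : Type u} [AddCommGroup E] [Module ℝ E] [TopologicalSpace E]
  [IsTopologicalAddGroup E] [ContinuousSMul ℝ E]

theorem isTopologicalAddGroup_and_continuousSMul_induced [T2Space E] (n : ℕ) :
    @IsTopologicalAddGroup (PathSpace E)
      ((tangentCompactOpen n (Icc (0 : ℝ) 1)).induced fun ξ => extendPath ξ.1) _ ∧
    @ContinuousSMul ℝ (PathSpace E) _ _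
      ((tangentCompactOpen n (Icc (0 : ℝ) 1)).induced fun ξ => extendPath ξ.1) :=
  isTopologicalAddGroup_and_continuousSMul_induced_tangentCompactOpen admitsDirections_Icc
    (fun ξ => ξ.2 n) (fun _ _ _ _ => rfl) (fun _ _ _ _ => rfl)

instance [T2Space E] : IsTopologicalAddGroup (PathSpace E) :=
  topologicalAddGroup_iInf fun n => (isTopologicalAddGroup_and_continuousSMul_induced n).1

instance [T2Space E] : ContinuousSMul ℝ (PathSpace E) :=
  continuousSMul_iInf fun n => (isTopologicalAddGroup_and_continuousSMul_induced n).2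

theorem tendsto_nhds_iff {α : Type*} {l : Filter α} {f : α → PathSpace E} {ξ : PathSpace E} :
    Tendsto f l (𝓝 ξ) ↔ ∀ n : ℕ, Tendsto (fun a => extendPath (f a).1) l
      (@nhds _ (tangentCompactOpen n (Icc (0 : ℝ) 1)) (extendPath ξ.1)) := by
  have hnhds : 𝓝 ξ = ⨅ n : ℕ, comap (fun ξ : PathSpace E => extendPath ξ.1)
      (@nhds _ (tangentCompactOpen n (Icc (0 : ℝ) 1)) (extendPath ξ.1)) :=
    (nhds_iInf (a := ξ)).trans
      (iInf_congr fun n => @nhds_induced _ _ (tangentCompactOpen n (Icc (0 : ℝ) 1)) _ _)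
  simp only [hnhds, tendsto_iInf, tendsto_comap_iff, Function.comp_def]

theorem exists_forall_eq {A : Type*} {Φ : A × ℝ → E} {W : Set A}
    (hΦ : ∀ a ∈ W, SmoothOn (fun t => Φ (a, t)) (Icc 0 1)) :
    ∃ f : A → PathSpace E, ∀ a ∈ W, ∀ t : unitInterval, (f a).1 t = Φ (a, t) := by
  have hslice (a : A) : ∃ ξ : PathSpace E, a ∈ W → ∀ t : unitInterval, ξ.1 t = Φ (a, t) := by
    by_cases ha : a ∈ W
    · exact ⟨⟨fun t => Φ (a, t), fun n => (hΦ a ha n).congr fun t ht =>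
        (extendPath_apply (fun t : unitInterval => Φ (a, t)) ⟨t, ht⟩).symm⟩, fun _ _ => rfl⟩
    · exact ⟨0, fun h => absurd h ha⟩
  exact ⟨fun a => (hslice a).choose, fun a => (hslice a).choose_spec⟩

end PathSpace

section ExponentialLaw

variable {E : Type v} [AddCommGroup E] [Module ℝ E] [TopologicalSpace E]
  [IsTopologicalAddGroup E] [ContinuousSMul ℝ E]

theorem SmoothOn.continuousOn_curry [T2Space E] {P : Type w} [AddCommGroup P] [Module ℝ P]
    [TopologicalSpace P] {Φ : P × ℝ → E} {Ω : Set (P × ℝ)} {W : Set P} {f : P → PathSpace E}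
    (hΩ : IsOpen Ω) (hW : W ×ˢ Icc (0 : ℝ) 1 ⊆ Ω) (hΦ : SmoothOn Φ Ω)
    (hf : ∀ p ∈ W, ∀ t : unitInterval, (f p).1 t = Φ (p, t)) : ContinuousOn f W :=
  fun _ hp => PathSpace.tendsto_nhds_iff.2 fun n =>
    tendsto_tangentCompactOpen_slice hΩ admitsDirections_Icc hW (hΦ n)
      (fun q hq => extendPath_eqOn (hf q hq)) hp

variable [LocallyConvexSpace ℝ E]

theorem SmoothOn.slice {P : Type w} [AddCommGroup P] [Module ℝ P] [TopologicalSpace P]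
    [IsTopologicalAddGroup P] [ContinuousSMul ℝ P] {Φ : P × ℝ → E} {Ω : Set (P × ℝ)}
    (hΩ : IsOpen Ω) (hΦ : SmoothOn Φ Ω) {I : Set ℝ} {p : P} (hp : MapsTo (Prod.mk p) I Ω) :
    SmoothOn (fun t => Φ (p, t)) I := fun n =>
  CnOn.comp hΩ (hΦ n)
    ((CnOn.const p I).prodMk (CnOn.continuousLinearMap (ContinuousLinearMap.id ℝ ℝ) I)) hp

theorem SmoothOn.hasDirDeriv_curry [T2Space E] {P : Type w} [AddCommGroup P] [Module ℝ P]
    [TopologicalSpace P] [IsTopologicalAddGroup P] [ContinuousSMul ℝ P] {Φ : P × ℝ → E}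
    {Ω : Set (P × ℝ)} {W : Set P} {f : P → PathSpace E} (hΩ : IsOpen Ω)
    (hW : W ×ˢ Icc (0 : ℝ) 1 ⊆ Ω) (hΦ : SmoothOn Φ Ω)
    (hf : ∀ p ∈ W, ∀ t : unitInterval, (f p).1 t = Φ (p, t)) {p q : P} (hp : p ∈ W)
    {ξ : PathSpace E} (hξ : ∀ t : unitInterval, HasDirDeriv Φ Ω (p, (t : ℝ)) (q, 0) (ξ.1 t)) :
    HasDirDeriv f W p q ξ := by
  refine PathSpace.tendsto_nhds_iff.2 fun n => tendsto_tangentCompactOpen_diffQuotient hΩ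
    admitsDirections_Icc hW (hΦ (n + 1)) (fun t _ htW s hs => ?_) (fun s hs => ?_) hp
  · have hslice (r : P) (hr : r ∈ W) := extendPath_eqOn (f := fun s => Φ (r, s)) (hf r hr) hs
    exact congrArg₂ (fun a b => t⁻¹ • (a - b)) (hslice _ htW) (hslice p hp)
  · rw [extendPath_apply ξ.1 ⟨s, hs⟩]
    exact hξ ⟨s, hs⟩

theorem CnOn.curry [T2Space E] {n : ℕ} : ∀ {P : Type w} [AddCommGroup P] [Module ℝ P]
    [TopologicalSpace P] [IsTopologicalAddGroup P] [ContinuousSMul ℝ P] {Φ : P × ℝ → E}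
    {Ω : Set (P × ℝ)} {W : Set P} {f : P → PathSpace E}, IsOpen Ω → W ×ˢ Icc (0 : ℝ) 1 ⊆ Ω →
    SmoothOn Φ Ω → (∀ p ∈ W, ∀ t : unitInterval, (f p).1 t = Φ (p, t)) → CnOn n f W := by
  induction n with
  | zero => exact fun hΩ hW hΦ hf => hΦ.continuousOn_curry hΩ hW hf
  | succ n ih =>
    intro P _ _ _ _ _ Φ Ω W f hΩ hW hΦ hf
    obtain ⟨D, hD, hD'⟩ := hΦ.exists_deriv (.of_isOpen hΩ)
    let A : (P × P) × ℝ →L[ℝ] P × ℝ :=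
      ((ContinuousLinearMap.fst ℝ P P).comp (ContinuousLinearMap.fst ℝ (P × P) ℝ)).prod
        (ContinuousLinearMap.snd ℝ (P × P) ℝ)
    let B : (P × P) × ℝ →L[ℝ] P × ℝ :=
      ((ContinuousLinearMap.snd ℝ P P).comp (ContinuousLinearMap.fst ℝ (P × P) ℝ)).prod 0
    have hΦ' : SmoothOn (fun z : (P × P) × ℝ => D ((z.1.1, z.2), (z.1.2, 0))) (A ⁻¹' Ω) :=
      fun n => ((hD' n).comp_linear (A.prod B)).mono fun z hz => ⟨hz, trivial⟩
    have hΩ' : IsOpen (A ⁻¹' Ω) := hΩ.preimage A.continuous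
    have hsub : (W ×ˢ (univ : Set P)) ×ˢ Icc (0 : ℝ) 1 ⊆ A ⁻¹' Ω :=
      fun z hz => hW ⟨hz.1.1, hz.2⟩
    obtain ⟨df, hdf⟩ := PathSpace.exists_forall_eq (W := W ×ˢ (univ : Set P))
      (Φ := fun z : (P × P) × ℝ => D ((z.1.1, z.2), (z.1.2, 0)))
      fun z hz => hΦ'.slice hΩ' fun t ht => hsub ⟨hz, ht⟩
    refine ⟨hΦ.continuousOn_curry hΩ hW hf, df, fun p hp q =>
      hΦ.hasDirDeriv_curry hΩ hW hf hp fun t => ?_, ih hΩ' hsub hΦ' hdf⟩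
    rw [hdf (p, q) ⟨hp, trivial⟩ t]
    exact hD _ (hW ⟨hp, t.2⟩) _

theorem SmoothOn.exists_curry [T2Space E] {P : Type w} [AddCommGroup P] [Module ℝ P]
    [TopologicalSpace P] [IsTopologicalAddGroup P] [ContinuousSMul ℝ P] {Φ : P × ℝ → E}
    {Ω : Set (P × ℝ)} {W : Set P} (hΩ : IsOpen Ω) (hW : W ×ˢ Icc (0 : ℝ) 1 ⊆ Ω)
    (hΦ : SmoothOn Φ Ω) : ∃ f : P → PathSpace E, SmoothOn f W ∧
      ∀ p ∈ W, ∀ t : unitInterval, (f p).1 t = Φ (p, t) := by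
  obtain ⟨f, hf⟩ := PathSpace.exists_forall_eq fun p hp =>
    hΦ.slice hΩ fun t ht => hW ⟨hp, ht⟩
  exact ⟨f, fun n => CnOn.curry hΩ hW hΦ hf, hf⟩

end ExponentialLaw

section LocalDom

variable {E : Type u} [TopologicalSpace E] {F : Type v} [TopologicalSpace F]
variable {M : Type u₁} [TopologicalSpace M] {N : Type u₂} [TopologicalSpace N]

theorem mem_localDom {e : OpenPartialHomeomorph M E} {e' : OpenPartialHomeomorph N F} {f : M → N}
    {x : M} (hx : x ∈ e.source) (hfx : f x ∈ e'.source) : e x ∈ localDom e e' f :=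
  ⟨e.map_source hx, by rwa [mem_preimage, mem_preimage, e.left_inv hx]⟩

theorem isOpen_localDom_inter_preimage (e : OpenPartialHomeomorph M E)
    (e' : OpenPartialHomeomorph N F) {f : M → N} {O : Set M} (hO : IsOpen O)
    (hf : ContinuousOn f O) : IsOpen (localDom e e' f ∩ e.symm ⁻¹' O) := by
  have := e.isOpen_inter_preimage_symm (hf.isOpen_inter_preimage hO e'.open_source)
  rwa [preimage_inter, inter_comm (e.symm ⁻¹' O), ← inter_assoc] at this

end LocalDom

section Manifold

variable {E : Type u} [AddCommGroup E] [Module ℝ E] [TopologicalSpace E]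
variable {F : Type v} [AddCommGroup F] [Module ℝ F] [TopologicalSpace F]
variable {H : Type w} [AddCommGroup H] [Module ℝ H] [TopologicalSpace H]
variable {M : Type u₁} [TopologicalSpace M]
variable {N : Type u₂} [TopologicalSpace N]
variable {P : Type u₃} [TopologicalSpace P]

section Basic

variable [ChartedSpace E M] [IsLCManifold E M] [ChartedSpace F N]

theorem Smooth.id : Smooth E E (fun x : M => x) :=
  ⟨continuous_id, IsLCManifold.smooth_chart_change⟩

theorem Smooth.fst : Smooth (ModelProd E F) E (fun z : M × N => z.1) := by
  refine ⟨continuous_fst, ?_⟩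
  rintro _ ⟨e₁, he₁, e₂, -, rfl⟩ e' he' n
  exact ((Smooth.id (E := E) (M := M)).2 e₁ he₁ e' he' n).comp_linear
    (ContinuousLinearMap.fst ℝ E F) |>.mono fun z hz => ⟨hz.1.1, hz.2⟩

theorem Smooth.snd : Smooth (ModelProd F E) E (fun z : N × M => z.2) := by
  refine ⟨continuous_snd, ?_⟩
  rintro _ ⟨e₁, -, e₂, he₂, rfl⟩ e' he' n
  exact ((Smooth.id (E := E) (M := M)).2 e₂ he₂ e' he' n).comp_linear
    (ContinuousLinearMap.snd ℝ F E) |>.mono fun z hz => ⟨hz.1.2, hz.2⟩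

end Basic

section ChartDeriv

/-- The tangent map `T_x f`, expressed in the charts `e` at `x` and `e'` at `f x`. -/
noncomputable def chartDeriv (e : OpenPartialHomeomorph M E) (e' : OpenPartialHomeomorph N F)
    (f : M → N) (x : M) (v : E) : F :=
  dirDeriv (localRep e e' f) (localDom e e' f) (e x) v

variable [IsTopologicalAddGroup E] [ContinuousSMul ℝ E]

theorem chartDeriv_id [T2Space E] (e : OpenPartialHomeomorph M E) {x : M} (hx : x ∈ e.source)
    (v : E) : chartDeriv e e (fun x => x) x v = v := by
  have hopen := isOpen_localDom e e (f := fun x => x) continuous_id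
  exact ((HasDirDeriv.linearMap .id _ _ _).congr (mem_localDom hx hx)
    fun y hy => (e.right_inv hy.1).symm).dirDeriv_eq (.of_isOpen hopen) (mem_localDom hx hx)

variable [ChartedSpace E M]

theorem Smooth.hasDirDeriv_localRep [T2Space F] [ChartedSpace F N] {f : M → N} (hf : Smooth E F f)
    {e : OpenPartialHomeomorph M E} (he : e ∈ atlas E M) {e' : OpenPartialHomeomorph N F}
    (he' : e' ∈ atlas F N) {y : E} (hy : y ∈ localDom e e' f) (v : E) :
    HasDirDeriv (localRep e e' f) (localDom e e' f) y v
      (dirDeriv (localRep e e' f) (localDom e e' f) y v) :=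
  SmoothOn.hasDirDeriv (hf.2 e he e' he') (.of_isOpen (isOpen_localDom e e' hf.1)) hy v

theorem Smooth.hasDirDeriv_comp [IsTopologicalAddGroup F] [ContinuousSMul ℝ F]
    [LocallyConvexSpace ℝ F] [T2Space F] [ChartedSpace F N] {f : M → N} (hf : Smooth E F f)
    {e : OpenPartialHomeomorph M E} (he : e ∈ atlas E M) {e' : OpenPartialHomeomorph N F}
    (he' : e' ∈ atlas F N) {X : Type*} [AddCommGroup X] [Module ℝ X] [TopologicalSpace X]
    [IsTopologicalAddGroup X] [ContinuousSMul ℝ X] {γ : X → M} {U V : Set X} (hV : IsOpen V)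
    (hγ : MapsTo γ V (e.source ∩ f ⁻¹' e'.source)) {x h : X} (hxU : x ∈ U) (hxV : x ∈ V) {v : E}
    (hv : HasDirDeriv (fun y => e (γ y)) U x h v) :
    HasDirDeriv (fun y => e' (f (γ y))) U x h (chartDeriv e e' f (γ x) v) := by
  have hopen := isOpen_localDom e e' hf.1
  have hmaps : MapsTo (fun y => e (γ y)) (U ∩ V) (localDom e e' f) := fun y hy =>
    mem_localDom (hγ hy.2).1 (hγ hy.2).2
  have hcomp := HasDirDeriv.comp
    (dg := fun z => dirDeriv (localRep e e' f) (localDom e e' f) z.1 z.2)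
    hopen hmaps (fun y hy k => hf.hasDirDeriv_localRep he he' hy k)
    ((SmoothOn.dirDeriv (hf.2 e he e' he') (.of_isOpen hopen)) 0) ⟨hxU, hxV⟩
    (hv.mono inter_subset_left)
  refine HasDirDeriv.of_inter hV hxV (hcomp.congr ⟨hxU, hxV⟩ fun y hy => ?_)
  simp only [localRep, e.left_inv (hγ hy.2).1]

theorem Smooth.hasDirDeriv_curve [IsTopologicalAddGroup F] [ContinuousSMul ℝ F]
    [LocallyConvexSpace ℝ F] [T2Space F] [ChartedSpace F N] {f : M → N} (hf : Smooth E F f)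
    {γ : ℝ → M} (hγ : Continuous γ) {e : OpenPartialHomeomorph M E} (he : e ∈ atlas E M)
    {e' : OpenPartialHomeomorph N F} (he' : e' ∈ atlas F N) {I : Set ℝ} {t : ℝ} (ht : t ∈ I)
    (hte : γ t ∈ e.source) (hte' : f (γ t) ∈ e'.source) {v : E}
    (hv : HasDirDeriv (fun s => e (γ s)) I t 1 v) :
    HasDirDeriv (fun s => e' (f (γ s))) I t 1 (chartDeriv e e' f (γ t) v) :=
  hf.hasDirDeriv_comp he he'
    ((e.open_source.inter (e'.open_source.preimage hf.1)).preimage hγ) (mapsTo_preimage _ _) ht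
    ⟨hte, hte'⟩ hv

theorem Smooth.chartDeriv_comp [IsTopologicalAddGroup F] [ContinuousSMul ℝ F]
    [LocallyConvexSpace ℝ F] [T2Space F] [ChartedSpace F N] [IsTopologicalAddGroup H]
    [ContinuousSMul ℝ H] [LocallyConvexSpace ℝ H] [T2Space H] [ChartedSpace H P] {g : N → P}
    {f : M → N} (hg : Smooth F H g) (hf : Smooth E F f) {e : OpenPartialHomeomorph M E}
    (he : e ∈ atlas E M) {e' : OpenPartialHomeomorph N F} (he' : e' ∈ atlas F N)
    {e'' : OpenPartialHomeomorph P H} (he'' : e'' ∈ atlas H P) {x : M} (hx : x ∈ e.source)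
    (hfx : f x ∈ e'.source) (hgfx : g (f x) ∈ e''.source) (v : E) :
    chartDeriv e' e'' g (f x) (chartDeriv e e' f x v) =
      chartDeriv e e'' (fun x => g (f x)) x v := by
  have hopen := isOpen_localDom e e' hf.1
  have hopen' := isOpen_localDom e e'' (hg.comp hf).1
  have hmem := mem_localDom hx hfx
  have hmem' : e x ∈ localDom e e'' fun x => g (f x) := mem_localDom hx hgfx
  have hcomp := hg.hasDirDeriv_comp he' he'' (hopen.inter hopen')
    (γ := fun y => f (e.symm y)) (fun y hy => ⟨hy.1.2, hy.2.2⟩) hmem ⟨hmem, hmem'⟩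
    (hf.hasDirDeriv_localRep he he' hmem v)
  rw [e.left_inv hx] at hcomp
  exact (((hcomp.mono inter_subset_right).of_inter hopen hmem).dirDeriv_eq
    (.of_isOpen hopen') hmem').symm

end ChartDeriv

section MSmoothOn

/-- Smoothness, on an open set `O`, of a map between manifolds modelled on `E` and `F`. For open
subsets of topological vector spaces this is `SmoothOn`. -/
def MSmoothOn (E : Type u) [AddCommGroup E] [Module ℝ E] [TopologicalSpace E]
    (F : Type v) [AddCommGroup F] [Module ℝ F] [TopologicalSpace F]
    [ChartedSpace E M] [ChartedSpace F N] (f : M → N) (O : Set M) : Prop :=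
  ContinuousOn f O ∧ ∀ e ∈ atlas E M, ∀ e' ∈ atlas F N,
    SmoothOn (localRep e e' f) (localDom e e' f ∩ e.symm ⁻¹' O)

theorem SmoothOn.mSmoothOn {f : E → F} {U : Set E} (hf : SmoothOn f U) : MSmoothOn E F f U := by
  refine ⟨(hf 0).continuousOn, ?_⟩
  rintro _ rfl _ rfl n
  exact (hf n).mono inter_subset_right

variable [ChartedSpace E M] [ChartedSpace F N] [ChartedSpace H P]

theorem Smooth.mSmoothOn {f : M → N} (hf : Smooth E F f) (O : Set M) : MSmoothOn E F f O :=
  ⟨hf.1.continuousOn, fun e he e' he' n => (hf.2 e he e' he' n).mono inter_subset_left⟩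

theorem mSmoothOn_chart [IsLCManifold E M] {e : OpenPartialHomeomorph M E} (he : e ∈ atlas E M) :
    MSmoothOn E E e e.source := by
  refine ⟨e.continuousOn, ?_⟩
  rintro e₁ he₁ _ rfl n
  exact (IsLCManifold.smooth_chart_change e₁ he₁ e he n).mono fun x hx => ⟨hx.1.1, hx.2⟩

namespace MSmoothOn

theorem mono {f : M → N} {O O' : Set M} (hf : MSmoothOn E F f O) (hO : O' ⊆ O) :
    MSmoothOn E F f O' :=
  ⟨hf.1.mono hO, fun e he e' he' n => (hf.2 e he e' he' n).mono fun _ hx => ⟨hx.1, hO hx.2⟩⟩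

theorem congr {f g : M → N} {O : Set M} (hf : MSmoothOn E F f O) (hfg : EqOn f g O) :
    MSmoothOn E F g O := by
  refine ⟨hf.1.congr hfg.symm, fun e he e' he' n => ?_⟩
  refine ((hf.2 e he e' he' n).mono fun x hx => ⟨⟨hx.1.1, ?_⟩, hx.2⟩).congr fun x hx => ?_
  · rw [mem_preimage, mem_preimage, hfg hx.2]
    exact hx.1.2
  · rw [localRep, localRep, hfg hx.2]

variable [IsTopologicalAddGroup E] [ContinuousSMul ℝ E]

theorem comp [IsTopologicalAddGroup F] [ContinuousSMul ℝ F] [IsTopologicalAddGroup H]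
    [ContinuousSMul ℝ H] [LocallyConvexSpace ℝ H] [T2Space H] {g : N → P} {f : M → N}
    {V : Set N} {O : Set M} (hg : MSmoothOn F H g V) (hf : MSmoothOn E F f O) (hV : IsOpen V)
    (hO : IsOpen O) (hOV : MapsTo f O V) : MSmoothOn E H (fun x => g (f x)) O := by
  have hc : ContinuousOn (fun x => g (f x)) O := hg.1.comp hf.1 hOV
  refine ⟨hc, fun e he e'' he'' n => CnOn.of_local (isOpen_localDom_inter_preimage e e'' hO hc)
    fun x hx => ?_⟩
  let e' := chartAt F (f (e.symm x))
  have he' : e' ∈ atlas F N := chart_mem_atlas F _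
  refine ⟨localDom e e' f ∩ e.symm ⁻¹' O, isOpen_localDom_inter_preimage e e' hO hf.1,
    ⟨⟨hx.1.1, mem_chart_source F _⟩, hx.2⟩, ?_⟩
  have hinv : ∀ y ∈ localDom e e' f, e'.symm (localRep e e' f y) = f (e.symm y) :=
    fun y hy => e'.left_inv hy.2
  refine (CnOn.comp (isOpen_localDom_inter_preimage e' e'' hV hg.1) (hg.2 e' he' e'' he'' n)
    ((hf.2 e he e' he' n).mono inter_subset_right) ?_).congr ?_
  · rintro y ⟨⟨hy, -⟩, hy', hyO⟩
    refine ⟨⟨e'.map_source hy'.2, ?_⟩, ?_⟩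
    · simpa only [mem_preimage, hinv y hy'] using hy.2
    · simpa only [mem_preimage, hinv y hy'] using hOV hyO
  · rintro y ⟨-, hy, -⟩
    exact congrArg (fun z => e'' (g z)) (hinv y hy)

end MSmoothOn

theorem Smooth.of_mSmoothOn [IsTopologicalAddGroup E] [ContinuousSMul ℝ E] [T2Space F] {f : M → N}
    (hf : ∀ x, ∃ O, IsOpen O ∧ x ∈ O ∧ MSmoothOn E F f O) : Smooth E F f := by
  have hc : Continuous f := continuous_iff_continuousAt.2 fun x =>
    let ⟨_, hO, hx, h⟩ := hf x
    h.1.continuousAt (hO.mem_nhds hx)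
  refine ⟨hc, fun e he e' he' n => CnOn.of_local (isOpen_localDom e e' hc) fun x hx => ?_⟩
  obtain ⟨O, hO, hxO, h⟩ := hf (e.symm x)
  refine ⟨e.target ∩ e.symm ⁻¹' O, e.isOpen_inter_preimage_symm hO, ⟨hx.1, hxO⟩, ?_⟩
  exact (h.2 e he e' he' n).mono fun y hy => ⟨hy.1, hy.2.2⟩

end MSmoothOn

end Manifold

section LieGroup

variable {E : Type u} [AddCommGroup E] [Module ℝ E] [TopologicalSpace E]
  [IsTopologicalAddGroup E] [ContinuousSMul ℝ E] [LocallyConvexSpace ℝ E] [T2Space E]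
variable {G : Type u₁} [TopologicalSpace G] [ChartedSpace E G] [Group G] [IsLCLieGroup E G]

section Operations

variable {F : Type v} [AddCommGroup F] [Module ℝ F] [TopologicalSpace F]
  [IsTopologicalAddGroup F] [ContinuousSMul ℝ F]
variable {N : Type u₂} [TopologicalSpace N] [ChartedSpace F N] {f g : N → G}

theorem Smooth.mul (hf : Smooth F E f) (hg : Smooth F E g) : Smooth F E (fun x => f x * g x) :=
  (IsLCLieGroup.smooth_mul (E := E) (G := G)).comp (hf.prodMk hg)

theorem Smooth.inv (hf : Smooth F E f) : Smooth F E (fun x => (f x)⁻¹) :=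
  (IsLCLieGroup.smooth_inv (E := E) (G := G)).comp hf

end Operations

variable (E) in
theorem smooth_mul_left (a : G) : Smooth E E (fun x : G => a * x) :=
  Smooth.mul (Smooth.const a) Smooth.id

theorem Smooth.of_mSmoothOn_one {F : Type v} [AddCommGroup F] [Module ℝ F] [TopologicalSpace F]
    [IsTopologicalAddGroup F] [ContinuousSMul ℝ F] [LocallyConvexSpace ℝ F] [T2Space F]
    {K : Type u₂} [TopologicalSpace K] [ChartedSpace F K] [Group K] [IsLCLieGroup F K]
    {φ : G →* K} {O : Set G} (hO : IsOpen O) (h1 : 1 ∈ O) (hφ : MSmoothOn E F φ O) :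
    Smooth E F φ := by
  refine Smooth.of_mSmoothOn fun g₀ => ?_
  have hl := smooth_mul_left E g₀⁻¹
  have hO' : IsOpen ((fun g => g₀⁻¹ * g) ⁻¹' O) := hO.preimage hl.1
  refine ⟨_, hO', by simpa using h1, ?_⟩
  refine (((smooth_mul_left F (φ g₀)).mSmoothOn univ).comp
    (hφ.comp (hl.mSmoothOn _) hO hO' (mapsTo_preimage _ _)) isOpen_univ hO'
    (mapsTo_univ _ _)).congr fun g _ => ?_
  simp only [map_mul, map_inv, mul_inv_cancel_left]

end LieGroup

section LogDeriv

variable (E : Type u) [AddCommGroup E] [Module ℝ E] [TopologicalSpace E]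
variable {G : Type u₁} [TopologicalSpace G] [ChartedSpace E G]

/-- The curve `γ` on `[0,1]` has the left logarithmic derivative `v ∈ T_1 G` at `t`, i.e. the curve
`γ(t)⁻¹ γ` has the derivative `v` at `t`, in the chart at `1`. -/
def HasLogDeriv [Group G] (γ : ℝ → G) (t : ℝ) (v : E) : Prop :=
  HasDirDeriv (fun s => chartAt E (1 : G) ((γ t)⁻¹ * γ s)) (Icc 0 1) t 1 v

variable {E}

theorem HasLogDeriv.congr [Group G] {γ η : ℝ → G} {t : ℝ} {v : E} (hγ : HasLogDeriv E γ t v)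
    (ht : t ∈ Icc (0 : ℝ) 1) (hγη : EqOn γ η (Icc 0 1)) : HasLogDeriv E η t v := by
  rw [HasLogDeriv, ← hγη ht]
  exact HasDirDeriv.congr hγ ht fun s hs => by rw [hγη hs]

variable [IsTopologicalAddGroup E] [ContinuousSMul ℝ E] [LocallyConvexSpace ℝ E] [T2Space E]

theorem eventually_eq_of_hasDirDeriv_zero {c : ℝ → G} (hc : Continuous c)
    (h : ∀ t ∈ Icc (0 : ℝ) 1, ∀ e ∈ atlas E G, c t ∈ e.source →
      HasDirDeriv (fun s => e (c s)) (Icc 0 1) t 1 0) {t₀ : ℝ} (ht₀ : t₀ ∈ Icc (0 : ℝ) 1) :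
    ∀ᶠ t in 𝓝 t₀, t ∈ Icc (0 : ℝ) 1 → c t = c t₀ := by
  let e := chartAt E (c t₀)
  have he : c t₀ ∈ e.source := mem_chart_source E _
  obtain ⟨r, hr, hrV⟩ := Metric.mem_nhds_iff.1 ((e.open_source.preimage hc).mem_nhds he)
  have hconv : Convex ℝ (Icc (0 : ℝ) 1 ∩ Metric.ball t₀ r) :=
    (convex_Icc 0 1).inter (convex_ball _ _)
  filter_upwards [Metric.ball_mem_nhds t₀ hr] with t htr ht
  refine e.injOn (hrV htr) he ?_
  by_contra hne
  obtain ⟨l, hl⟩ := geometric_hahn_banach_point_point hne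
  have hderiv : ∀ s ∈ Icc (0 : ℝ) 1 ∩ Metric.ball t₀ r,
      HasDerivWithinAt (fun s => l (e (c s))) 0 (Icc 0 1 ∩ Metric.ball t₀ r) s := by
    intro s hs
    have := (h s hs.1 e (chart_mem_atlas E _) (hrV hs.2)).clm_comp l
    rw [map_zero] at this
    exact this.hasDerivWithinAt.mono inter_subset_left
  have := hconv.norm_image_sub_le_of_norm_hasDerivWithin_le (C := 0) hderiv (fun _ _ => by simp)
    ⟨ht₀, Metric.mem_ball_self hr⟩ ⟨ht, htr⟩
  rw [zero_mul, norm_le_zero_iff, sub_eq_zero] at this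
  exact hl.ne this

theorem eq_of_hasDirDeriv_zero {c : ℝ → G} (hc : Continuous c)
    (h : ∀ t ∈ Icc (0 : ℝ) 1, ∀ e ∈ atlas E G, c t ∈ e.source →
      HasDirDeriv (fun s => e (c s)) (Icc 0 1) t 1 0) (t : unitInterval) : c t = c 0 := by
  have hloc : IsLocallyConstant fun t : unitInterval => c t := by
    rw [IsLocallyConstant.iff_eventually_eq]
    intro t₀
    filter_upwards [continuous_subtype_val.continuousAt.eventually
      (eventually_eq_of_hasDirDeriv_zero hc h t₀.2)] with t ht using ht t.2
  exact hloc.apply_eq_of_preconnectedSpace t 0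

variable [Group G] [IsLCLieGroup E G]

theorem SmoothPath.hasLogDeriv {η : unitInterval → G} (hη : SmoothPath E η) {t : unitInterval}
    {v : E} (hv : pathDeriv E η t = tangentMapAt E E (fun g : G => η t * g) 1 v) :
    HasLogDeriv E (extendPath η) t v := by
  have hc : Continuous (extendPath η) := hη.1.Icc_extend'
  have ht : extendPath η t = η t := extendPath_apply η t
  let e := chartAt E (η t)
  let e₁ := chartAt E (1 : G)
  have he : e ∈ atlas E G := chart_mem_atlas E _
  have he₁ : e₁ ∈ atlas E G := chart_mem_atlas E _
  have hte : η t ∈ e.source := mem_chart_source E _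
  have h1 : (1 : G) ∈ e₁.source := mem_chart_source E _
  have hV : IsOpen (extendPath η ⁻¹' e.source) := e.open_source.preimage hc
  have htV : (t : ℝ) ∈ extendPath η ⁻¹' e.source := by rwa [mem_preimage, ht]
  have hpath : HasDirDeriv (fun s => e (extendPath η s)) (Icc 0 1) t 1 (pathDeriv E η t) :=
    ((hη.2 e he).hasDirDeriv (admitsDirections_Icc.inter_isOpen hV) ⟨t.2, htV⟩ 1).of_inter hV htV
  have hlog := (smooth_mul_left E (η t)⁻¹).hasDirDeriv_curve hc he he₁ t.2 htV
    (by rwa [ht, inv_mul_cancel]) hpath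
  have hv' : pathDeriv E η t = chartDeriv e₁ e (fun g => η t * g) 1 v := by
    simpa only [tangentMapAt, chartDeriv, mul_one] using hv
  have hcancel : chartDeriv e e₁ (fun g => (η t)⁻¹ * g) (η t) (pathDeriv E η t) = v := by
    have := Smooth.chartDeriv_comp (smooth_mul_left E (η t)⁻¹) (smooth_mul_left E (η t))
      he₁ he he₁ h1 (by rwa [mul_one]) (by rwa [mul_one, inv_mul_cancel]) v
    simpa only [hv', mul_one, inv_mul_cancel_left, chartDeriv_id e₁ h1] using this
  rwa [ht, hcancel, ← ht] at hlog

namespace HasLogDeriv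

theorem map {E' : Type v} [AddCommGroup E'] [Module ℝ E'] [TopologicalSpace E']
    [IsTopologicalAddGroup E'] [ContinuousSMul ℝ E'] [LocallyConvexSpace ℝ E'] [T2Space E']
    {K : Type u₂} [TopologicalSpace K] [ChartedSpace E' K] [Group K]
    {f : G →* K} (hf : Smooth E E' f) {γ : ℝ → G} (hγ : Continuous γ) {t : ℝ} (ht : t ∈ Icc 0 1)
    {v : E} (hv : HasLogDeriv E γ t v) :
    HasLogDeriv E' (fun s => f (γ s)) t (tangentMapAt E E' f 1 v) := by
  have h1 : (γ t)⁻¹ * γ t = 1 := inv_mul_cancel _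
  have hc : Continuous fun s => (γ t)⁻¹ * γ s := (smooth_mul_left E (γ t)⁻¹).1.comp hγ
  have hcurve := hf.hasDirDeriv_curve hc (chart_mem_atlas E (1 : G)) (chart_mem_atlas E' (1 : K)) ht
    (by rw [h1]; exact mem_chart_source E _)
    (by rw [h1, map_one]; exact mem_chart_source E' _) hv
  simp only [h1, map_mul, map_inv] at hcurve
  simpa only [HasLogDeriv, tangentMapAt, chartDeriv, map_one] using hcurve

variable {γ η : ℝ → G}

/- Put `α = γ(t)⁻¹ γ` and `β = η(t)⁻¹ η`. The curves `(α, β)` and `(α, α)` in `G × G` have the same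
derivative at `t`, hence so have `α β⁻¹` and the constant curve `α α⁻¹`. -/
theorem hasDirDeriv_mul_inv (hγ : Continuous γ) (hη : Continuous η) {t : ℝ}
    (ht : t ∈ Icc (0 : ℝ) 1) {v : E} (hγv : HasLogDeriv E γ t v) (hηv : HasLogDeriv E η t v)
    {e : OpenPartialHomeomorph G E} (he : e ∈ atlas E G) (hte : γ t * (η t)⁻¹ ∈ e.source) :
    HasDirDeriv (fun s => e (γ s * (η s)⁻¹)) (Icc 0 1) t 1 0 := by
  let e₁ := chartAt E (1 : G)
  let f : G × G → G := fun z => γ t * (z.1 * z.2⁻¹) * (η t)⁻¹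
  have hf : Smooth (ModelProd E E) E f :=
    ((Smooth.const _).mul (Smooth.fst.mul Smooth.snd.inv)).mul (Smooth.const _)
  let α : ℝ → G := fun s => (γ t)⁻¹ * γ s
  let β : ℝ → G := fun s => (η t)⁻¹ * η s
  have hα : Continuous α := (smooth_mul_left E _).1.comp hγ
  have hβ : Continuous β := (smooth_mul_left E _).1.comp hη
  have hα1 : α t = 1 := inv_mul_cancel _
  have hβ1 : β t = 1 := inv_mul_cancel _
  have h1 : (1 : G) ∈ e₁.source := mem_chart_source E _
  have he₁ : (e₁.prod e₁ : OpenPartialHomeomorph (G × G) (ModelProd E E)) ∈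
      atlas (ModelProd E E) (G × G) :=
    ⟨e₁, chart_mem_atlas E _, e₁, chart_mem_atlas E _, rfl⟩
  have hdiag := hf.hasDirDeriv_curve (hα.prodMk hα) he₁ he ht (by simpa [hα1] using h1)
    (by simpa [f] using hte) (HasDirDeriv.prodMk hγv hγv)
  have hpair := hf.hasDirDeriv_curve (hα.prodMk hβ) he₁ he ht (by simpa [hα1, hβ1] using h1)
    (by simpa [f, hα1, hβ1] using hte) (HasDirDeriv.prodMk hγv hηv)
  have hzero := (hdiag.congr (g := fun _ => e (γ t * (η t)⁻¹)) ht fun s _ => by simp [f]).unique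
    (.const _ _ _ _) admitsDirections_Icc ht
  rw [hα1] at hzero
  rw [hα1, hβ1, hzero] at hpair
  exact hpair.congr ht fun s _ => by simp [f, α, β, mul_assoc]

theorem eq_of_eq (hγ : Continuous γ) (hη : Continuous η) {ξ : ℝ → E}
    (hγξ : ∀ t ∈ Icc (0 : ℝ) 1, HasLogDeriv E γ t (ξ t))
    (hηξ : ∀ t ∈ Icc (0 : ℝ) 1, HasLogDeriv E η t (ξ t)) (h0 : γ 0 = η 0) (t : unitInterval) :
    γ t = η t := by
  have hcont : Continuous fun s => γ s * (η s)⁻¹ :=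
    (IsLCLieGroup.smooth_mul (E := E) (G := G)).1.comp
      (hγ.prodMk ((IsLCLieGroup.smooth_inv (E := E) (G := G)).1.comp hη))
  have hconst := eq_of_hasDirDeriv_zero (E := E) hcont (fun t ht e he hte =>
    (hγξ t ht).hasDirDeriv_mul_inv hγ hη ht (hηξ t ht) he hte) t
  rw [h0, mul_inv_cancel] at hconst
  exact mul_inv_eq_one.1 hconst

end HasLogDeriv

end LogDeriv

section MaurerCartan

variable {E : Type u} [TopologicalSpace E]
variable (G : Type u₁) [TopologicalSpace G] [ChartedSpace E G] [Group G]

variable {G} in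
theorem diag_mem_localDom_inv_mul {x : E} (hx : x ∈ (chartAt E (1 : G)).target) :
    (x, x) ∈ localDom ((chartAt E (1 : G)).prod (chartAt E (1 : G))) (chartAt E (1 : G))
      (fun z : G × G => z.1⁻¹ * z.2) :=
  ⟨⟨hx, hx⟩, by simp⟩

variable [AddCommGroup E] [Module ℝ E]

/-- The left Maurer-Cartan form `(x, v) ↦ T(λ_{x⁻¹}) v` of `G`, in the chart at `1`. It is taken as
the partial derivative of `(x, y) ↦ x⁻¹ y` in `y` at `y = x`, so that it is smooth in `x`, too. -/
noncomputable def maurerCartan (z : E × E) : E :=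
  let e := chartAt E (1 : G)
  dirDeriv (X := E × E) (localRep (e.prod e) e fun z : G × G => z.1⁻¹ * z.2)
    (localDom (e.prod e) e fun z : G × G => z.1⁻¹ * z.2) (z.1, z.1) (0, z.2)

variable [IsTopologicalAddGroup E] [ContinuousSMul ℝ E] [LocallyConvexSpace ℝ E] [T2Space E]
  [IsLCLieGroup E G]

theorem smooth_inv_mul : Smooth (ModelProd E E) E fun z : G × G => z.1⁻¹ * z.2 :=
  Smooth.fst.inv.mul Smooth.snd

theorem isOpen_localDom_inv_mul : IsOpen (X := E × E)
    (localDom ((chartAt E (1 : G)).prod (chartAt E (1 : G))) (chartAt E (1 : G))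
      fun z : G × G => z.1⁻¹ * z.2) :=
  isOpen_localDom _ _ (smooth_inv_mul (E := E) G).1

theorem smoothOn_localRep_inv_mul : SmoothOn (X := E × E)
    (localRep ((chartAt E (1 : G)).prod (chartAt E (1 : G))) (chartAt E (1 : G))
      fun z : G × G => z.1⁻¹ * z.2)
    (localDom ((chartAt E (1 : G)).prod (chartAt E (1 : G))) (chartAt E (1 : G))
      fun z : G × G => z.1⁻¹ * z.2) :=
  (smooth_inv_mul G).2 _ ⟨_, chart_mem_atlas E _, _, chart_mem_atlas E _, rfl⟩ _
    (chart_mem_atlas E _)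

theorem smoothOn_maurerCartan :
    SmoothOn (maurerCartan (E := E) G) ((chartAt E (1 : G)).target ×ˢ univ) := by
  intro n
  have hopen := isOpen_localDom_inv_mul (E := E) G
  have hderiv := (smoothOn_localRep_inv_mul (E := E) G).dirDeriv (.of_isOpen hopen) n
  let L : E × E →L[ℝ] (E × E) × (E × E) :=
    ((ContinuousLinearMap.fst ℝ E E).prod (ContinuousLinearMap.fst ℝ E E)).prod
      ((0 : E × E →L[ℝ] E).prod (ContinuousLinearMap.snd ℝ E E))
  exact (hderiv.comp_linear L).mono fun z hz => ⟨diag_mem_localDom_inv_mul hz.1, trivial⟩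

variable {G}

theorem hasLogDeriv_chartAt_symm {c : ℝ → E} (hc : Continuous c) {t : ℝ} (ht : t ∈ Icc (0 : ℝ) 1)
    (hct : c t ∈ (chartAt E (1 : G)).target) {v : E} (hv : HasDirDeriv c (Icc 0 1) t 1 v) :
    HasLogDeriv E (fun s => (chartAt E (1 : G)).symm (c s)) t (maurerCartan G (c t, v)) := by
  let e := chartAt E (1 : G)
  let D : Set (E × E) := localDom (e.prod e) e fun z : G × G => z.1⁻¹ * z.2
  have hopen : IsOpen D := isOpen_localDom_inv_mul G
  have hsmooth := smoothOn_localRep_inv_mul (E := E) G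
  let c₂ : ℝ → E × E := fun s => (c t, c s)
  have hc₂ : Continuous c₂ := by fun_prop
  have hmem : t ∈ c₂ ⁻¹' D := diag_mem_localDom_inv_mul hct
  refine HasDirDeriv.of_inter (hopen.preimage hc₂) hmem ?_
  exact HasDirDeriv.comp (U := Icc 0 1 ∩ c₂ ⁻¹' D) (x := t)
    (g := localRep (e.prod e) e fun z : G × G => z.1⁻¹ * z.2)
    (dg := fun z => dirDeriv _ D z.1 z.2) hopen (fun _ hs => hs.2)
    (fun y hy k => hsmooth.hasDirDeriv (.of_isOpen hopen) hy k)
    (hsmooth.dirDeriv (.of_isOpen hopen) 0) ⟨ht, hmem⟩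
    (((HasDirDeriv.const (c t) _ _ _).prodMk hv).mono inter_subset_left)

end MaurerCartan

section Segments

variable {E : Type u} [AddCommGroup E] [Module ℝ E] [TopologicalSpace E]
variable (G : Type u₁) [TopologicalSpace G] [ChartedSpace E G] [Group G]

/-- The curve in `G` that is the segment from `e 1` to `p` in the chart `e` at `1`. -/
noncomputable def segmentPath (p : E) (t : unitInterval) : G :=
  (chartAt E (1 : G)).symm (chartAt E (1 : G) 1 + (t : ℝ) • (p - chartAt E (1 : G) 1))

/-- The parameters `(p, t)` for which the point at time `t` of the segment from `e 1` to `p` lies in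
the target of the chart `e` at `1`. -/
def segmentDom : Set (E × ℝ) :=
  {z | chartAt E (1 : G) 1 + z.2 • (z.1 - chartAt E (1 : G) 1) ∈ (chartAt E (1 : G)).target}

/-- The left logarithmic derivative of `segmentPath G p` at time `t`, as a function of `(p, t)`. -/
noncomputable def segmentLogDeriv (z : E × ℝ) : E :=
  maurerCartan G (chartAt E (1 : G) 1 + z.2 • (z.1 - chartAt E (1 : G) 1),
    z.1 - chartAt E (1 : G) 1)

variable {G} in
theorem extendPath_segmentPath_zero {p : E} : extendPath (segmentPath G p) 0 = 1 := by
  refine (extendPath_apply _ 0).trans ?_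
  simp [segmentPath, (chartAt E (1 : G)).left_inv (mem_chart_source E _)]

variable {G} in
theorem extendPath_segmentPath_one {p : E} :
    extendPath (segmentPath G p) 1 = (chartAt E (1 : G)).symm p := by
  refine (extendPath_apply _ 1).trans ?_
  simp [segmentPath]

variable [IsTopologicalAddGroup E] [ContinuousSMul ℝ E]

theorem isOpen_segmentDom : IsOpen (segmentDom (E := E) G) :=
  (chartAt E (1 : G)).open_target.preimage (by fun_prop)

variable {G} in
theorem continuous_segmentPath {p : E} (hp : ∀ t ∈ Icc (0 : ℝ) 1, (p, t) ∈ segmentDom G) :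
    Continuous (segmentPath G p) := by
  refine ContinuousOn.comp_continuous (chartAt E (1 : G)).continuousOn_symm ?_ fun t => hp t t.2
  fun_prop

variable [LocallyConvexSpace ℝ E] [T2Space E] [IsLCLieGroup E G]

theorem smoothOn_segmentLogDeriv : SmoothOn (segmentLogDeriv (E := E) G) (segmentDom G) := by
  intro n
  have hv : CnOn n (fun z : E × ℝ => z.1 - chartAt E (1 : G) 1) (segmentDom G) := by
    simp only [sub_eq_add_neg]
    exact (CnOn.continuousLinearMap (.fst ℝ E ℝ) _).add (CnOn.const _ _)
  have hx : CnOn n (fun z : E × ℝ => chartAt E (1 : G) 1 + z.2 • (z.1 - chartAt E (1 : G) 1))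
      (segmentDom G) :=
    (CnOn.const _ _).add ((CnOn.continuousLinearMap (.snd ℝ E ℝ) _).smul hv)
  have hcomp := CnOn.comp ((chartAt E (1 : G)).open_target.prod isOpen_univ)
    (smoothOn_maurerCartan G n) (hx.prodMk hv) fun z hz => ⟨hz, trivial⟩
  exact hcomp

variable {G}

theorem hasLogDeriv_segmentPath {p : E} {t : ℝ} (ht : t ∈ Icc (0 : ℝ) 1)
    (hpt : (p, t) ∈ segmentDom G) :
    HasLogDeriv E (extendPath (segmentPath G p)) t (segmentLogDeriv G (p, t)) := by
  let x := chartAt E (1 : G) 1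
  have hline : HasDirDeriv (fun s : ℝ => x + s • (p - x)) (Icc 0 1) t 1 (p - x) := by
    have hadd := (HasDirDeriv.const x (Icc (0 : ℝ) 1) t 1).add
      (.linearMap (LinearMap.toSpanSingleton ℝ E (p - x)) _ _ _)
    rwa [zero_add, LinearMap.toSpanSingleton_apply_one] at hadd
  exact (hasLogDeriv_chartAt_symm (by fun_prop) ht hpt hline).congr ht
    (extendPath_eqOn fun _ => rfl).symm

end Segments

section Rigidity

theorem exists_isOpen_convex_subset {X : Type*} [AddCommGroup X] [Module ℝ X] [TopologicalSpace X]
    [IsTopologicalAddGroup X] [ContinuousSMul ℝ X] [LocallyConvexSpace ℝ X] {U : Set X}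
    (hU : IsOpen U) {x : X} (hx : x ∈ U) : ∃ W, IsOpen W ∧ x ∈ W ∧ Convex ℝ W ∧ W ⊆ U := by
  obtain ⟨V, ⟨hV, hVc⟩, hVU⟩ :=
    (LocallyConvexSpace.convex_basis (𝕜 := ℝ) x).mem_iff.1 (hU.mem_nhds hx)
  exact ⟨interior V, isOpen_interior, mem_interior_iff_mem_nhds.2 hV, hVc.interior,
    interior_subset.trans hVU⟩

variable {E₁ : Type u} [AddCommGroup E₁] [Module ℝ E₁] [TopologicalSpace E₁]
  [IsTopologicalAddGroup E₁] [ContinuousSMul ℝ E₁] [LocallyConvexSpace ℝ E₁] [T2Space E₁]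
variable {E₂ : Type v} [AddCommGroup E₂] [Module ℝ E₂] [TopologicalSpace E₂]
  [IsTopologicalAddGroup E₂] [ContinuousSMul ℝ E₂] [LocallyConvexSpace ℝ E₂] [T2Space E₂]
variable {E : Type w} [AddCommGroup E] [Module ℝ E] [TopologicalSpace E]
  [IsTopologicalAddGroup E] [ContinuousSMul ℝ E] [LocallyConvexSpace ℝ E] [T2Space E]
variable {G₁ : Type u₁} [TopologicalSpace G₁] [ChartedSpace E₁ G₁] [Group G₁] [IsLCLieGroup E₁ G₁]
variable {G₂ : Type u₂} [TopologicalSpace G₂] [ChartedSpace E₂ G₂] [Group G₂] [IsLCLieGroup E₂ G₂]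
variable {K : Type u₃} [TopologicalSpace K] [ChartedSpace E K] [Group K] [IsLCLieGroup E K]
variable {φ : G₁ →* G₂} {ι : Type*} {g : ι → G₂ →* K}

variable (G₁) in
theorem exists_smoothOn_pathSpace_segmentLogDeriv (L : E₁ →L[ℝ] E₂) :
    ∃ (W : Set E₁) (f : E₁ → PathSpace E₂), IsOpen W ∧ chartAt E₁ (1 : G₁) 1 ∈ W ∧
      W ×ˢ Icc (0 : ℝ) 1 ⊆ segmentDom G₁ ∧ SmoothOn f W ∧
      ∀ p ∈ W, ∀ t : unitInterval, (f p).1 t = L (segmentLogDeriv G₁ (p, t)) := by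
  let e := chartAt E₁ (1 : G₁)
  obtain ⟨W, hWo, h1W, hWc, hWe⟩ := exists_isOpen_convex_subset e.open_target
    (e.map_source (mem_chart_source E₁ _))
  have hW : W ×ˢ Icc (0 : ℝ) 1 ⊆ segmentDom G₁ := fun z hz =>
    hWe (hWc.add_smul_sub_mem h1W hz.1 hz.2)
  obtain ⟨f, hf, hfW⟩ := SmoothOn.exists_curry (isOpen_segmentDom G₁) hW
    fun n => CnOn.linear_comp L (smoothOn_segmentLogDeriv G₁ n)
  exact ⟨W, f, hWo, h1W, hW, hf, hfW⟩

theorem HasLogDeriv.eq_map_of_separating (hg : ∀ m, Smooth E₂ E (g m))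
    (hgφ : ∀ m, Smooth E₁ E (fun x => g m (φ x))) (hsep : ∀ x y, (∀ m, g m x = g m y) → x = y)
    {L : E₁ → E₂}
    (hL : ∀ m v, tangentMapAt E₂ E (g m) 1 (L v) = tangentMapAt E₁ E (fun x => g m (φ x)) 1 v)
    {γ : ℝ → G₁} {η : ℝ → G₂} (hγ : Continuous γ) (hη : Continuous η) {ξ : ℝ → E₁}
    (hγξ : ∀ t ∈ Icc (0 : ℝ) 1, HasLogDeriv E₁ γ t (ξ t))
    (hηξ : ∀ t ∈ Icc (0 : ℝ) 1, HasLogDeriv E₂ η t (L (ξ t))) (h0 : η 0 = φ (γ 0))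
    (t : unitInterval) : η t = φ (γ t) := by
  refine hsep _ _ fun m => ?_
  have hηm : ∀ t ∈ Icc (0 : ℝ) 1, HasLogDeriv E (fun s => g m (η s)) t
      (tangentMapAt E₁ E (fun x => g m (φ x)) 1 (ξ t)) := fun t ht =>
    hL m (ξ t) ▸ (hηξ t ht).map (hg m) hη ht
  have hγm : ∀ t ∈ Icc (0 : ℝ) 1, HasLogDeriv E (fun s => g m (φ (γ s))) t
      (tangentMapAt E₁ E (fun x => g m (φ x)) 1 (ξ t)) := fun t ht =>
    (hγξ t ht).map (f := (g m).comp φ) (hgφ m) hγ ht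
  exact HasLogDeriv.eq_of_eq (γ := fun s => g m (η s)) (η := fun s => g m (φ (γ s)))
    ((hg m).1.comp hη) ((hgφ m).1.comp hγ) hηm hγm (congrArg (g m) h0) t

theorem IsRegular.smooth_of_separating (hG₂ : IsRegular E₂ G₂) (L : E₁ →L[ℝ] E₂)
    (hg : ∀ m, Smooth E₂ E (g m)) (hgφ : ∀ m, Smooth E₁ E (fun x => g m (φ x)))
    (hsep : ∀ x y, (∀ m, g m x = g m y) → x = y)
    (hL : ∀ m v, tangentMapAt E₂ E (g m) 1 (L v) = tangentMapAt E₁ E (fun x => g m (φ x)) 1 v) :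
    Smooth E₁ E₂ φ := by
  obtain ⟨Evol, hEvol, hsmooth⟩ := hG₂
  obtain ⟨W, f, hWo, h1W, hWdom, hf, hfW⟩ := exists_smoothOn_pathSpace_segmentLogDeriv G₁ L
  let e := chartAt E₁ (1 : G₁)
  have hφW : ∀ p ∈ W, Evol (f p) 1 = φ (e.symm p) := by
    intro p hp
    obtain ⟨hsm, hstart, hder⟩ := hEvol (f p)
    have hp' : ∀ t ∈ Icc (0 : ℝ) 1, (p, t) ∈ segmentDom G₁ := fun t ht => hWdom ⟨hp, ht⟩
    have hlog : ∀ t ∈ Icc (0 : ℝ) 1,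
        HasLogDeriv E₂ (extendPath (Evol (f p))) t (L (segmentLogDeriv G₁ (p, t))) := by
      intro t ht
      have hlog := hsm.hasLogDeriv (hder ⟨t, ht⟩)
      rwa [hfW p hp] at hlog
    have h0 : extendPath (Evol (f p)) 0 = φ (extendPath (segmentPath G₁ p) 0) := by
      rw [extendPath_segmentPath_zero, map_one, ← hstart]
      exact extendPath_apply _ 0
    have hend : extendPath (Evol (f p)) 1 = φ (extendPath (segmentPath G₁ p) 1) :=
      HasLogDeriv.eq_map_of_separating hg hgφ hsep hL
        (continuous_segmentPath hp').Icc_extend' hsm.1.Icc_extend'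
        (fun t ht => hasLogDeriv_segmentPath ht (hp' t ht)) hlog h0 1
    rw [extendPath_segmentPath_one] at hend
    exact (extendPath_apply _ 1).symm.trans hend
  have hO : IsOpen (e.source ∩ e ⁻¹' W) := e.isOpen_inter_preimage hWo
  refine Smooth.of_mSmoothOn_one hO ⟨mem_chart_source E₁ _, h1W⟩ ?_
  have hEvolf : MSmoothOn E₁ E₂ (fun p => Evol (f p) 1) W :=
    (hsmooth.mSmoothOn univ).comp hf.mSmoothOn isOpen_univ hWo (mapsTo_univ _ _)
  have he : MSmoothOn E₁ E₁ e (e.source ∩ e ⁻¹' W) :=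
    (mSmoothOn_chart (chart_mem_atlas E₁ _)).mono inter_subset_left
  refine (hEvolf.comp he hWo hO fun _ hx => hx.2).congr ?_
  intro x hx
  exact (hφW (e x) hx.2).trans (congrArg φ (e.left_inv hx.1))

end Rigidity

section Main

variable {F : Type u} [AddCommGroup F] [Module ℝ F] [TopologicalSpace F]
  [IsTopologicalAddGroup F] [ContinuousSMul ℝ F]
variable {M : Type u₁} [TopologicalSpace M] [ChartedSpace F M]
variable {E : Type v} [AddCommGroup E] [Module ℝ E] [TopologicalSpace E]
  [IsTopologicalAddGroup E] [ContinuousSMul ℝ E] [LocallyConvexSpace ℝ E] [T2Space E]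
variable {K : Type u₂} [TopologicalSpace K] [ChartedSpace E K] [Group K] [IsLCLieGroup E K]

/-- The map `evalAt`, as a homomorphism of groups. -/
def evalHom {E' : Type*} [AddCommGroup E'] [Module ℝ E'] [TopologicalSpace E']
    (S : LieGroupStructure E' (MappingGroup F M E K)) (m : M) : S.Space →* K where
  toFun := evalAt S m
  map_one' := rfl
  map_mul' := fun _ _ => rfl

variable {E₁ : Type*} [AddCommGroup E₁] [Module ℝ E₁] [TopologicalSpace E₁]
  [IsTopologicalAddGroup E₁] [ContinuousSMul ℝ E₁] [LocallyConvexSpace ℝ E₁] [T2Space E₁]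
variable {E₂ : Type*} [AddCommGroup E₂] [Module ℝ E₂] [TopologicalSpace E₂]
  [IsTopologicalAddGroup E₂] [ContinuousSMul ℝ E₂] [LocallyConvexSpace ℝ E₂] [T2Space E₂]
variable {S₁ : LieGroupStructure E₁ (MappingGroup F M E K)}
variable {S₂ : LieGroupStructure E₂ (MappingGroup F M E K)}

theorem CompatibleWithEvaluations.smooth_idMap (hc₁ : CompatibleWithEvaluations S₁)
    (hc₂ : CompatibleWithEvaluations S₂) (hS₂ : IsRegular E₂ S₂.Space) :
    Smooth E₁ E₂ (S₁.idMap S₂) := by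
  obtain ⟨hev₁, θ₁, -, hθ₁⟩ := hc₁
  obtain ⟨hev₂, θ₂, -, hθ₂⟩ := hc₂
  let φ : S₁.Space →* S₂.Space :=
    { toFun := S₁.idMap S₂, map_one' := rfl, map_mul' := fun _ _ => rfl }
  refine hS₂.smooth_of_separating (E := E) (K := K) (φ := φ) (g := evalHom S₂)
    (θ₁.trans θ₂.symm : E₁ →L[ℝ] E₂) hev₂ hev₁ (fun x y h => Subtype.ext (funext h)) fun m v => ?_
  calc tangentMapAt E₂ E (evalAt S₂ m) 1 (θ₂.symm (θ₁ v))
    _ = (θ₁ v).1 m := by rw [hθ₂, θ₂.apply_symm_apply]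
    _ = tangentMapAt E₁ E (evalAt S₁ m) 1 v := (hθ₁ m v).symm

end Main

end LCCalculus

theorem corollaryI10_general
    {F : Type*} [AddCommGroup F] [Module ℝ F] [TopologicalSpace F] [IsTopologicalAddGroup F]
    [ContinuousSMul ℝ F]
    {M : Type*} [TopologicalSpace M] [ChartedSpace F M]
    {E : Type*} [AddCommGroup E] [Module ℝ E] [TopologicalSpace E] [IsTopologicalAddGroup E]
    [ContinuousSMul ℝ E] [LocallyConvexSpace ℝ E] [T2Space E]
    {K : Type*} [TopologicalSpace K] [ChartedSpace E K] [Group K] [LCCalculus.IsLCLieGroup E K]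
    {E₁ : Type*} [AddCommGroup E₁] [Module ℝ E₁] [TopologicalSpace E₁] [IsTopologicalAddGroup E₁]
    [ContinuousSMul ℝ E₁] [LocallyConvexSpace ℝ E₁] [T2Space E₁]
    {E₂ : Type*} [AddCommGroup E₂] [Module ℝ E₂] [TopologicalSpace E₂] [IsTopologicalAddGroup E₂]
    [ContinuousSMul ℝ E₂] [LocallyConvexSpace ℝ E₂] [T2Space E₂]
    (S₁ : LCCalculus.LieGroupStructure E₁ (LCCalculus.MappingGroup F M E K))
    (hS₁ : LCCalculus.IsRegular E₁ S₁.Space)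
    (hc₁ : LCCalculus.CompatibleWithEvaluations S₁)
    (S₂ : LCCalculus.LieGroupStructure E₂ (LCCalculus.MappingGroup F M E K))
    (hS₂ : LCCalculus.IsRegular E₂ S₂.Space)
    (hc₂ : LCCalculus.CompatibleWithEvaluations S₂) :
    S₁.Same S₂ :=
  ⟨hc₁.smooth_idMap hc₂ hS₂, hc₂.smooth_idMap hc₁ hS₁⟩

/-- For a connected finite-dimensional manifold `M` and a regular Lie group `K`, any two regular Lie
group structures on `C^∞(M,K)` that are compatible with evaluations coincide. -/
theorem corollaryI10
    {F : Type*} [NormedAddCommGroup F] [NormedSpace ℝ F] [FiniteDimensional ℝ F]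
    {M : Type*} [TopologicalSpace M] [T2Space M] [ConnectedSpace M] [ChartedSpace F M]
    [LCCalculus.IsLCManifold F M]
    {E : Type*} [AddCommGroup E] [Module ℝ E] [TopologicalSpace E] [IsTopologicalAddGroup E]
    [ContinuousSMul ℝ E] [LocallyConvexSpace ℝ E] [T2Space E]
    {K : Type*} [TopologicalSpace K] [ChartedSpace E K] [Group K] [LCCalculus.IsLCLieGroup E K]
    (hK : LCCalculus.IsRegular E K)
    {E₁ : Type*} [AddCommGroup E₁] [Module ℝ E₁] [TopologicalSpace E₁] [IsTopologicalAddGroup E₁]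
    [ContinuousSMul ℝ E₁] [LocallyConvexSpace ℝ E₁] [T2Space E₁]
    {E₂ : Type*} [AddCommGroup E₂] [Module ℝ E₂] [TopologicalSpace E₂] [IsTopologicalAddGroup E₂]
    [ContinuousSMul ℝ E₂] [LocallyConvexSpace ℝ E₂] [T2Space E₂]
    (S₁ : LCCalculus.LieGroupStructure E₁ (LCCalculus.MappingGroup F M E K))
    (hS₁ : LCCalculus.IsRegular E₁ S₁.Space)
    (hc₁ : LCCalculus.CompatibleWithEvaluations S₁)
    (S₂ : LCCalculus.LieGroupStructure E₂ (LCCalculus.MappingGroup F M E K))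
    (hS₂ : LCCalculus.IsRegular E₂ S₂.Space)
    (hc₂ : LCCalculus.CompatibleWithEvaluations S₂) :
    S₁.Same S₂ :=
  corollaryI10_general S₁ hS₁ hc₁ S₂ hS₂ hc₂
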